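/- Let $M,T\ge 1$ and $N$ be integers and let $\rho_{ij}^2\ge 0$ ($1\le i\le N$, $1\le j\le M$) be arbitrary link strengths. Consider the block-fading noncoherent MIMO channel with $M$ transmit antennas, $N$ receive antennas and coherence time $T$, $$Y=GX+W,$$ where $X$ is the random $M\times T$ complex input matrix, the $N\times M$ matrix $G$ has independent entries $g_{ij}\sim\mathcal{CN}(0,\rho_{ij}^2)$, the $N\times T$ matrix $W$ has i.i.d. $\mathcal{CN}(0,1)$ entries, and $X,G,W$ are independent (neither end knows $G$). Let $$C=\sup I(X;Y),$$ where the supremum is over all laws of $X$ satisfying the power constraint $$\frac1{MT}\sum_{m=1}^M\sum_{t=1}^T\mathbb E|x_{mt}|^2=1 .$$ Then the capacity $C$ is achieved by an input of the form $X=LQ$: there are a random lower triangular $M\times T$ matrix $L$ (that is, $L_{ij}=0$ whenever $j>i$) and an isotropically (Haar) distributed random $T\times T$ unitary matrix $Q$, independent of $L$, such that $X=LQ$ satisfies the power constraint and $I(X;Y)=C$. -/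

import Mathlib

open MeasureTheory ProbabilityTheory
open scoped ENNReal NNReal

namespace NoncoherentMIMO

noncomputable section

/-- Complex matrices carry the product σ-algebra of their entries, which is the Borel σ-algebra. -/
instance instMeasurableSpaceMatrix {m n : ℕ} : MeasurableSpace (Matrix (Fin m) (Fin n) ℂ) :=
  inferInstanceAs (MeasurableSpace (Fin m → Fin n → ℂ))

/-- `CN(0, σ²)` with `σ² = v`: real and imaginary parts are independent `N(0, v / 2)`. -/
def complexGaussian (v : ℝ≥0) : Measure ℂ :=
  ((gaussianReal 0 (v / 2)).prod (gaussianReal 0 (v / 2))).map (fun p => (⟨p.1, p.2⟩ : ℂ))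

/-- The law of an `m × n` random matrix with independent entries, the `(i, j)` entry being
`CN(0, v i j)`. -/
def gaussianMatrix {m n : ℕ} (v : Fin m → Fin n → ℝ≥0) : Measure (Matrix (Fin m) (Fin n) ℂ) :=
  (Measure.pi fun i => Measure.pi fun j => complexGaussian (v i j)).map
    (fun A => Matrix.of A)

/-- The joint law of `(X, Y)` for the channel `Y = G X + W` over one coherence block, where `X` has
law `μ`, `G` has independent entries `CN(0, v i j)`, `W` has i.i.d. entries `CN(0, 1)`, and
`X`, `G`, `W` are independent. -/
def jointLaw {M N T : ℕ} (v : Fin N → Fin M → ℝ≥0) (μ : Measure (Matrix (Fin M) (Fin T) ℂ)) :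
    Measure (Matrix (Fin M) (Fin T) ℂ × Matrix (Fin N) (Fin T) ℂ) :=
  (μ.prod ((gaussianMatrix v).prod (gaussianMatrix fun _ _ => 1))).map
    (fun p => (p.1, p.2.1 * p.1 + p.2.2))

/-- The mutual information `I(X; Y)`, in bits, between the input `X` with law `μ` and the output
`Y`: the divergence of the joint law from the product of its marginals. -/
def mutualInfo {M N T : ℕ} (v : Fin N → Fin M → ℝ≥0) (μ : Measure (Matrix (Fin M) (Fin T) ℂ)) :
    ℝ≥0∞ :=
  InformationTheory.klDiv (jointLaw v μ) ((jointLaw v μ).fst.prod (jointLaw v μ).snd) /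
    ENNReal.ofReal (Real.log 2)

/-- The average power `(1 / (M T)) ∑ₘ ∑ₜ E |x_{mt}|²` of an input with law `μ`. -/
def avgPower {M T : ℕ} (μ : Measure (Matrix (Fin M) (Fin T) ℂ)) : ℝ≥0∞ :=
  (∑ m, ∑ t, ∫⁻ X, ‖X m t‖ₑ ^ 2 ∂μ) / ((M : ℝ≥0∞) * (T : ℝ≥0∞))

/-- The capacity (in bits per coherence block of `T` symbols): the supremum of `I(X; Y)` over all
input laws of average power `1`. -/
def capacity {M N : ℕ} (T : ℕ) (v : Fin N → Fin M → ℝ≥0) : ℝ≥0∞ :=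
  ⨆ (μ : Measure (Matrix (Fin M) (Fin T) ℂ)) (_ : IsProbabilityMeasure μ) (_ : avgPower μ = 1),
    mutualInfo v μ

/-- A possibly rectangular matrix is lower triangular if its entries above the main diagonal
vanish. -/
def IsLowerTriangular {M T : ℕ} (L : Matrix (Fin M) (Fin T) ℂ) : Prop :=
  ∀ (i : Fin M) (j : Fin T), (i : ℕ) < (j : ℕ) → L i j = 0

end

end NoncoherentMIMO

/-! Right multiplication by a unitary `U` preserves Lebesgue measure and the noise density, so the
input `x U` gives `y` the density that `x` gives `y U⁻¹`. Replacing `X` by `X Q`, with `Q` Haar and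
independent of `X`, therefore leaves h(Y|X) unchanged and averages the output density over the
unitary group, which by concavity of entropy cannot decrease h(Y). This is
`mutualInfo_le_mutualInfo_isotropize`. By invariance of Haar measure the law of `X Q` depends only
on the right unitary orbits of `X` (`map_mul_eq_isotropize`), and Householder reflections carry `X`
measurably to a lower triangular point of its orbit (`exists_measurable_lowerTriangular`). Any
optimal input can thus be traded for one of the form `L Q`.

It remains to show that the supremum is attained. Put ℓ(y) = ∑ |y_ij|, f(x) = E[ℓ(Y) | X = x] and Z
= ∫ exp(-ℓ). Then I(X;Y) + h(Y|X) + `outGap` + 1 = Z + E f(X). By Fatou, h(Y|X) and `outGap` are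
weakly lower semicontinuous. As f grows at most linearly, E f(X) is continuous along weakly
convergent sequences of bounded power. So I(X;Y) is upper semicontinuous under a power bound, and
Prokhorov's theorem gives a maximiser among inputs of power at most the budget
(`IsChannelDensity.exists_isMaxOn_divergence`). Equality in the power constraint is recovered by
amplification, which loses nothing by data processing (`mutualInfo_le_mutualInfo_smul`).

The noise density is at most one, so every entropy integrand is nonnegative. The identities live in
[0, ∞] in additive form, and terms are cancelled only once they are known to be finite. -/

namespace NoncoherentMIMO

open Filter Topology Real InformationTheory

/-! ### Entropy identities for a channel with a bounded density -/

section Channel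

variable {E F : Type*} [MeasurableSpace E] [MeasurableSpace F]

/-- `p x y` is a strictly positive transition density, bounded by one, with respect to `vol`. -/
structure IsChannelDensity (vol : Measure F) (p : E → F → ℝ) : Prop where
  measurable : Measurable fun z : E × F => p z.1 z.2
  pos : ∀ x y, 0 < p x y
  le_one : ∀ x y, p x y ≤ 1
  lintegral_eq_one : ∀ x, ∫⁻ y, ENNReal.ofReal (p x y) ∂vol = 1

/-- The density of the output when the input has law `μ`. -/
noncomputable def outDensity (p : E → F → ℝ) (μ : Measure E) (y : F) : ℝ := ∫ x, p x y ∂μ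

/-- The conditional differential entropy of the output given the input. -/
noncomputable def condEntropy (vol : Measure F) (p : E → F → ℝ) (μ : Measure E) : ℝ≥0∞ :=
  ∫⁻ y, ∫⁻ x, ENNReal.ofReal (negMulLog (p x y)) ∂μ ∂vol

/-- The differential entropy of the output. -/
noncomputable def outEntropy (vol : Measure F) (p : E → F → ℝ) (μ : Measure E) : ℝ≥0∞ :=
  ∫⁻ y, ENNReal.ofReal (negMulLog (outDensity p μ y)) ∂vol

/-- The mutual information, in nats, of the channel with transition density `p`. -/
noncomputable def divergence (vol : Measure F) (p : E → F → ℝ) (μ : Measure E) : ℝ≥0∞ :=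
  klDiv ((μ.prod vol).withDensity fun z => ENNReal.ofReal (p z.1 z.2))
    (μ.prod (vol.withDensity fun y => ENNReal.ofReal (outDensity p μ y)))

/-- The divergence of the output from the measure with density `exp (-ℓ)`. -/
noncomputable def outGap (vol : Measure F) (p : E → F → ℝ) (ℓ : F → ℝ) (μ : Measure E) : ℝ≥0∞ :=
  ∫⁻ y, ENNReal.ofReal (exp (-ℓ y) * klFun (outDensity p μ y * exp (ℓ y))) ∂vol

namespace IsChannelDensity

variable {vol : Measure F} {p : E → F → ℝ}

lemma measurable_left (hp : IsChannelDensity vol p) (y : F) : Measurable fun x => p x y :=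
  hp.measurable.comp (by fun_prop : Measurable fun x : E => (x, y))

lemma integrable (hp : IsChannelDensity vol p) (μ : Measure E) [IsFiniteMeasure μ]
    (y : F) : Integrable (fun x => p x y) μ :=
  Integrable.of_bound (hp.measurable_left y).aestronglyMeasurable 1
    (ae_of_all _ fun x => by
      rw [norm_of_nonneg (hp.pos x y).le]; exact hp.le_one x y)

lemma ofReal_outDensity (hp : IsChannelDensity vol p) (μ : Measure E) [IsFiniteMeasure μ] (y : F) :
    ENNReal.ofReal (outDensity p μ y) = ∫⁻ x, ENNReal.ofReal (p x y) ∂μ :=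
  ofReal_integral_eq_lintegral_ofReal (hp.integrable μ y) (ae_of_all _ fun x => (hp.pos x y).le)

variable (μ : Measure E) [IsProbabilityMeasure μ]

lemma outDensity_pos (hp : IsChannelDensity vol p) (y : F) : 0 < outDensity p μ y := by
  unfold outDensity
  rw [integral_pos_iff_support_of_nonneg (fun x => (hp.pos x y).le) (hp.integrable μ y)]
  have : Function.support (fun x => p x y) = Set.univ := by
    ext x; simpa using (hp.pos x y).ne'
  simp [this]

lemma outDensity_le_one (hp : IsChannelDensity vol p) (y : F) : outDensity p μ y ≤ 1 := by
  calc ∫ x, p x y ∂μ ≤ ∫ _, (1 : ℝ) ∂μ :=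
        integral_mono (hp.integrable μ y) (integrable_const _) fun x => hp.le_one x y
    _ = 1 := by simp

lemma measurable_outDensity (hp : IsChannelDensity vol p) : Measurable (outDensity p μ) := by
  have : StronglyMeasurable fun z : F × E => p z.2 z.1 :=
    (hp.measurable.comp measurable_swap).stronglyMeasurable
  exact this.integral_prod_right.measurable

variable [SigmaFinite vol]

lemma lintegral_outDensity (hp : IsChannelDensity vol p) :
    ∫⁻ y, ENNReal.ofReal (outDensity p μ y) ∂vol = 1 := by
  simp_rw [hp.ofReal_outDensity μ]
  rw [lintegral_lintegral_swap]
  · simp [hp.lintegral_eq_one]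
  · exact ((hp.measurable.comp measurable_swap).ennreal_ofReal).aemeasurable

/-- This is I(X;Y) = h(Y) - h(Y|X), kept additive so that it also holds when the terms are infinite.
All three terms are integrals over the same product measure, so a pointwise identity suffices. -/
lemma divergence_add_condEntropy (hp : IsChannelDensity vol p) :
    divergence vol p μ + condEntropy vol p μ = outEntropy vol p μ := by
  set q := outDensity p μ with hq
  have hqm : Measurable q := hp.measurable_outDensity μ
  have hq0 : ∀ y, 0 < q y := hp.outDensity_pos μ
  have hq1 : ∀ y, q y ≤ 1 := hp.outDensity_le_one μ
  have hpm := hp.measurable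
  let J := μ.prod vol
  have : IsFiniteMeasure (vol.withDensity fun y => ENNReal.ofReal (q y)) :=
    isFiniteMeasure_withDensity (by rw [hp.lintegral_outDensity μ]; simp)
  let ν := μ.prod (vol.withDensity fun y => ENNReal.ofReal (q y))
  have hν : ν = J.withDensity fun z => ENNReal.ofReal (q z.2) :=
    prod_withDensity_right (by fun_prop)
  have hJ : J.withDensity (fun z => ENNReal.ofReal (p z.1 z.2)) =
      ν.withDensity fun z => ENNReal.ofReal (p z.1 z.2 / q z.2) := by
    rw [hν, ← withDensity_mul _ (by fun_prop) (by fun_prop)]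
    congr 1
    ext z
    rw [Pi.mul_apply, ← ENNReal.ofReal_mul (hq0 _).le, mul_div_cancel₀ _ (hq0 _).ne']
  have hfin : IsFiniteMeasure (J.withDensity (fun z => ENNReal.ofReal (p z.1 z.2))) := by
    refine isFiniteMeasure_withDensity ?_
    rw [lintegral_prod _ (by fun_prop)]
    simp [hp.lintegral_eq_one]
  have hD : divergence vol p μ =
      ∫⁻ z, ENNReal.ofReal (q z.2) * ENNReal.ofReal (klFun (p z.1 z.2 / q z.2)) ∂J := by
    change klDiv (J.withDensity fun z => ENNReal.ofReal (p z.1 z.2)) ν = _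
    rw [klDiv_eq_lintegral_klFun_of_ac (by rw [hJ]; exact withDensity_absolutelyContinuous _ _)]
    have h1 : ∀ᵐ z ∂ν, ENNReal.ofReal (klFun
        ((J.withDensity fun z => ENNReal.ofReal (p z.1 z.2)).rnDeriv ν z).toReal) =
        ENNReal.ofReal (klFun (p z.1 z.2 / q z.2)) := by
      have := Measure.rnDeriv_withDensity ν
        (f := fun z : E × F => ENNReal.ofReal (p z.1 z.2 / q z.2)) (by fun_prop)
      rw [hJ]
      filter_upwards [this] with z hz
      rw [hz, ENNReal.toReal_ofReal (div_pos (hp.pos _ _) (hq0 _)).le]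
    rw [lintegral_congr_ae h1, hν,
      lintegral_withDensity_eq_lintegral_mul _ (by fun_prop) (by fun_prop)]
    rfl
  have hnm : Measurable fun z : E × F => ENNReal.ofReal (negMulLog (p z.1 z.2)) := by
    have := continuous_negMulLog.measurable; fun_prop
  have hH : condEntropy vol p μ = ∫⁻ z, ENNReal.ofReal (negMulLog (p z.1 z.2)) ∂J := by
    rw [lintegral_prod_symm _ hnm.aemeasurable]; rfl
  have hone : (1 : ℝ≥0∞) = ∫⁻ z, ENNReal.ofReal (p z.1 z.2) ∂J := by
    rw [lintegral_prod _ (by fun_prop)]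
    simp [hp.lintegral_eq_one]
  have hone' : (1 : ℝ≥0∞) = ∫⁻ z, ENNReal.ofReal (q z.2) ∂J := by
    rw [lintegral_prod _ (by fun_prop)]
    simp [hq, hp.lintegral_outDensity μ]
  have hO : outEntropy vol p μ =
      ∫⁻ z, ENNReal.ofReal (p z.1 z.2) * ENNReal.ofReal (-log (q z.2)) ∂J := by
    rw [lintegral_prod_symm _ (by fun_prop)]
    refine lintegral_congr fun y => ?_
    dsimp only
    rw [lintegral_mul_const _ (hp.measurable_left y).ennreal_ofReal, ← hp.ofReal_outDensity μ,
      ← ENNReal.ofReal_mul (hq0 _).le, negMulLog]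
    congr 1; ring
  -- The integrand of the divergence is `q * klFun (p / q) = p * log (p / q) + q - p`. Adding 1 to
  -- both sides, as the mass of `p` on the left and of `q` on the right, absorbs the linear terms
  -- and keeps every integrand nonnegative.
  rw [← ENNReal.add_left_inj ENNReal.one_ne_top]
  conv_lhs => rw [hone]
  conv_rhs => rw [hone']
  rw [hD, hH, hO, ← lintegral_add_right _ hnm, ← lintegral_add_right _ (by fun_prop),
    ← lintegral_add_right _ (by fun_prop)]
  refine lintegral_congr fun z => ?_
  have h1 := hp.pos z.1 z.2
  have h2 := hq0 z.2
  have h3 : 0 ≤ negMulLog (p z.1 z.2) := negMulLog_nonneg h1.le (hp.le_one _ _)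
  have h4 : 0 ≤ klFun (p z.1 z.2 / q z.2) := klFun_nonneg (div_pos h1 h2).le
  have h5 : 0 ≤ -log (q z.2) := by simpa using log_nonpos h2.le (hq1 _)
  rw [← ENNReal.ofReal_mul h2.le, ← ENNReal.ofReal_mul h1.le,
    ← ENNReal.ofReal_add (by positivity) h3,
    ← ENNReal.ofReal_add (by positivity) h1.le, ← ENNReal.ofReal_add (by positivity) h2.le]
  congr 1
  rw [klFun_apply, log_div h1.ne' h2.ne', negMulLog]
  field_simp
  ring

/-- Gibbs' inequality with its defect kept: the cross entropy of the output relative to `exp (-ℓ)`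
exceeds its entropy by the divergence. The 1 is the mass of the output and Z that of `exp (-ℓ)`,
which need not be normalised. The gain is that the cross entropy is linear in the input law. -/
lemma outEntropy_add_outGap (hp : IsChannelDensity vol p) {ℓ : F → ℝ} (hℓ : Measurable ℓ)
    (hℓ0 : ∀ y, 0 ≤ ℓ y) :
    outEntropy vol p μ + outGap vol p ℓ μ + 1 = ∫⁻ y, ENNReal.ofReal (exp (-ℓ y)) ∂vol +
      ∫⁻ x, ∫⁻ y, ENNReal.ofReal (p x y) * ENNReal.ofReal (ℓ y) ∂vol ∂μ := by
  have hqm : Measurable (outDensity p μ) := hp.measurable_outDensity μ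
  have hpm := hp.measurable
  have hnm := continuous_negMulLog.measurable
  rw [← hp.lintegral_outDensity μ, lintegral_lintegral_swap (by fun_prop)]
  have hm : ∀ y, ∫⁻ x, ENNReal.ofReal (p x y) * ENNReal.ofReal (ℓ y) ∂μ =
      ENNReal.ofReal (outDensity p μ y) * ENNReal.ofReal (ℓ y) := fun y => by
    rw [lintegral_mul_const _ (hp.measurable_left y).ennreal_ofReal, ← hp.ofReal_outDensity μ]
  simp_rw [hm]
  unfold outEntropy outGap
  rw [← lintegral_add_left (by fun_prop), ← lintegral_add_right _ (by fun_prop),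
    ← lintegral_add_left (by fun_prop)]
  refine lintegral_congr fun y => ?_
  have h1 := hp.outDensity_pos μ y
  have h3 := negMulLog_nonneg h1.le (hp.outDensity_le_one μ y)
  have h4 : 0 ≤ klFun (outDensity p μ y * exp (ℓ y)) := klFun_nonneg (by positivity)
  have h5 := hℓ0 y
  rw [← ENNReal.ofReal_mul h1.le, ← ENNReal.ofReal_add h3 (by positivity),
    ← ENNReal.ofReal_add (by positivity) h1.le,
    ← ENNReal.ofReal_add (by positivity) (by positivity)]
  congr 1
  rw [klFun_apply, log_mul h1.ne' (exp_pos _).ne', log_exp, negMulLog, exp_neg]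
  field_simp
  ring

end IsChannelDensity

/-! ### Semicontinuity under weak convergence and existence of a maximiser -/

section Topological

variable [TopologicalSpace E] [OpensMeasurableSpace E]

lemma liminf_add_liminf_le (u v : ℕ → ℝ≥0∞) :
    liminf u atTop + liminf v atTop ≤ liminf (fun n => u n + v n) atTop := by
  simp only [liminf_eq_iSup_iInf_of_nat']
  rw [ENNReal.iSup_add_iSup_of_monotone]
  · exact iSup_mono fun n => le_iInf fun i => add_le_add (iInf_le _ i) (iInf_le _ i)
  all_goals
    intro m n hmn
    refine le_iInf fun i => (iInf_le _ (i + (n - m))).trans (le_of_eq ?_)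
    congr 1; omega

lemma tendsto_integral_of_bounded {μs : ℕ → ProbabilityMeasure E} {μ : ProbabilityMeasure E}
    (h : Tendsto μs atTop (𝓝 μ)) {f : E → ℝ} (hf : Continuous f) {C : ℝ}
    (hC : ∀ x, |f x| ≤ C) :
    Tendsto (fun n => ∫ x, f x ∂(μs n : Measure E)) atTop (𝓝 (∫ x, f x ∂(μ : Measure E))) :=
  ProbabilityMeasure.tendsto_iff_forall_integral_tendsto.1 h
    (BoundedContinuousFunction.ofNormedAddCommGroup f hf C hC)

lemma tendsto_lintegral_of_bounded {μs : ℕ → ProbabilityMeasure E} {μ : ProbabilityMeasure E}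
    (h : Tendsto μs atTop (𝓝 μ)) {f : E → ℝ} (hf : Continuous f) (h0 : ∀ x, 0 ≤ f x) {C : ℝ}
    (hC : ∀ x, f x ≤ C) :
    Tendsto (fun n => ∫⁻ x, ENNReal.ofReal (f x) ∂(μs n : Measure E)) atTop
      (𝓝 (∫⁻ x, ENNReal.ofReal (f x) ∂(μ : Measure E))) := by
  have hC' : ∀ x, |f x| ≤ C := fun x => by rw [abs_of_nonneg (h0 x)]; exact hC x
  have key : ∀ ν : ProbabilityMeasure E, ∫⁻ x, ENNReal.ofReal (f x) ∂(ν : Measure E) =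
      ENNReal.ofReal (∫ x, f x ∂(ν : Measure E)) := fun ν =>
    (ofReal_integral_eq_lintegral_ofReal
      (Integrable.of_bound hf.measurable.aestronglyMeasurable C (ae_of_all _ hC'))
      (ae_of_all _ h0)).symm
  simp_rw [key]
  exact ENNReal.tendsto_ofReal (tendsto_integral_of_bounded h hf hC')

/-- Each truncation `min f k` is bounded and continuous, so its integrals converge; monotone
convergence in `k` then removes the truncation. -/
lemma lintegral_le_liminf_of_tendsto {μs : ℕ → ProbabilityMeasure E} {μ : ProbabilityMeasure E}
    (h : Tendsto μs atTop (𝓝 μ)) {f : E → ℝ} (hf : Continuous f) (h0 : ∀ x, 0 ≤ f x) :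
    ∫⁻ x, ENNReal.ofReal (f x) ∂(μ : Measure E) ≤
      liminf (fun n => ∫⁻ x, ENNReal.ofReal (f x) ∂(μs n : Measure E)) atTop := by
  have h1 : Tendsto (fun k : ℕ => ∫⁻ x, ENNReal.ofReal (min (f x) k) ∂(μ : Measure E)) atTop
      (𝓝 (∫⁻ x, ENNReal.ofReal (f x) ∂(μ : Measure E))) := by
    refine lintegral_tendsto_of_tendsto_of_monotone
      (fun k => (hf.measurable.min measurable_const).ennreal_ofReal.aemeasurable)
      (ae_of_all _ fun x i j hij => ENNReal.ofReal_le_ofReal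
        (min_le_min le_rfl (by exact_mod_cast hij))) (ae_of_all _ fun x => ?_)
    refine tendsto_const_nhds.congr' ?_
    filter_upwards [eventually_ge_atTop ⌈f x⌉₊] with k hk
    rw [min_eq_left ((Nat.le_ceil _).trans (by exact_mod_cast hk))]
  refine le_of_tendsto' h1 fun k => ?_
  rw [← (tendsto_lintegral_of_bounded h (f := fun x => min (f x) k) (by fun_prop)
    (fun x => le_min (h0 x) (by positivity)) (fun x => min_le_right _ _)).liminf_eq]
  exact liminf_le_liminf (Eventually.of_forall fun n => lintegral_mono fun x =>
    ENNReal.ofReal_le_ofReal (min_le_left _ _))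

/-- Weak convergence passes to the upper limit of integrals of functions with uniformly bounded
second moments. -/
lemma limsup_lintegral_le_of_sq_bounded {μs : ℕ → ProbabilityMeasure E} {μ : ProbabilityMeasure E}
    (h : Tendsto μs atTop (𝓝 μ)) {f : E → ℝ} (hf : Continuous f) (h0 : ∀ x, 0 ≤ f x) {B : ℝ≥0∞}
    (hB : B ≠ ∞) (hfB : ∀ n, ∫⁻ x, ENNReal.ofReal (f x ^ 2) ∂(μs n : Measure E) ≤ B) :
    limsup (fun n => ∫⁻ x, ENNReal.ofReal (f x) ∂(μs n : Measure E)) atTop ≤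
      ∫⁻ x, ENNReal.ofReal (f x) ∂(μ : Measure E) := by
  have hk : ∀ k : ℕ, limsup (fun n => ∫⁻ x, ENNReal.ofReal (f x) ∂(μs n : Measure E)) atTop ≤
      ∫⁻ x, ENNReal.ofReal (f x) ∂(μ : Measure E) + B * ENNReal.ofReal (1 / (k + 1 : ℝ)) := by
    intro k
    set K : ℝ := k + 1
    have hK : 0 < K := by positivity
    -- From `f ≤ min f K + f² / K`: the part lost by truncating is at most `B / K`, uniformly in
    -- `n`.
    have hb : ∀ n, ∫⁻ x, ENNReal.ofReal (f x) ∂(μs n : Measure E) ≤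
        ∫⁻ x, ENNReal.ofReal (min (f x) K) ∂(μs n : Measure E) + B * ENNReal.ofReal (1 / K) := by
      intro n
      calc ∫⁻ x, ENNReal.ofReal (f x) ∂(μs n : Measure E)
          ≤ ∫⁻ x, (ENNReal.ofReal (min (f x) K) + ENNReal.ofReal (f x ^ 2) * ENNReal.ofReal (1 / K))
              ∂(μs n : Measure E) := by
            refine lintegral_mono fun x => ?_
            rw [← ENNReal.ofReal_mul (by positivity),
              ← ENNReal.ofReal_add (le_min (h0 x) hK.le) (by positivity)]
            refine ENNReal.ofReal_le_ofReal ?_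
            rcases le_total (f x) K with hx | hx
            · rw [min_eq_left hx]
              have : 0 ≤ f x ^ 2 * (1 / K) := by positivity
              linarith
            · rw [min_eq_right hx]
              have : f x ≤ f x ^ 2 * (1 / K) := by
                rw [mul_one_div, le_div_iff₀ hK]; nlinarith [h0 x]
              linarith
        _ = ∫⁻ x, ENNReal.ofReal (min (f x) K) ∂(μs n : Measure E) +
              (∫⁻ x, ENNReal.ofReal (f x ^ 2) ∂(μs n : Measure E)) * ENNReal.ofReal (1 / K) := by
            rw [lintegral_add_left (hf.measurable.min measurable_const).ennreal_ofReal,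
              lintegral_mul_const _ (hf.measurable.pow_const 2).ennreal_ofReal]
        _ ≤ _ := by gcongr; exact hfB n
    have ht := (tendsto_lintegral_of_bounded h (f := fun x => min (f x) K) (by fun_prop)
      (fun x => le_min (h0 x) hK.le) (fun x => min_le_right _ _)).add_const
        (B * ENNReal.ofReal (1 / K))
    calc _ ≤ limsup (fun n => ∫⁻ x, ENNReal.ofReal (min (f x) K) ∂(μs n : Measure E) +
          B * ENNReal.ofReal (1 / K)) atTop := limsup_le_limsup (Eventually.of_forall hb)
      _ = _ := ht.limsup_eq
      _ ≤ _ := by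
        gcongr
        exact min_le_left _ _
  have ht : Tendsto (fun k : ℕ => ∫⁻ x, ENNReal.ofReal (f x) ∂(μ : Measure E) +
      B * ENNReal.ofReal (1 / (k + 1 : ℝ))) atTop
      (𝓝 (∫⁻ x, ENNReal.ofReal (f x) ∂(μ : Measure E) + B * 0)) := by
    refine Tendsto.const_add _ (ENNReal.Tendsto.const_mul ?_ (Or.inr hB))
    have := ENNReal.tendsto_ofReal tendsto_one_div_add_atTop_nhds_zero_nat
    simpa using this
  simpa using ge_of_tendsto' ht hk

variable {vol : Measure F} {p : E → F → ℝ}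

lemma negMulLog_le_one {x : ℝ} (h0 : 0 < x) : negMulLog x ≤ 1 := by
  have := klFun_nonneg h0.le
  rw [klFun_apply] at this
  rw [negMulLog]; linarith

/-- For fixed `y` the inner integrand is continuous with values in `[0, 1]`, so the inner integral
converges; Fatou's lemma in `y` does the rest. -/
lemma IsChannelDensity.condEntropy_le_liminf (hp : IsChannelDensity vol p)
    (hc : ∀ y, Continuous fun x => p x y) {μs : ℕ → ProbabilityMeasure E}
    {μ : ProbabilityMeasure E} (h : Tendsto μs atTop (𝓝 μ)) :
    condEntropy vol p μ ≤ liminf (fun n => condEntropy vol p (μs n)) atTop := by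
  have hpm := hp.measurable
  have hnm := continuous_negMulLog.measurable
  refine le_trans (lintegral_mono fun y => ?_) (lintegral_liminf_le fun n => ?_)
  · refine le_of_eq (Tendsto.liminf_eq ?_).symm
    exact tendsto_lintegral_of_bounded h (continuous_negMulLog.comp (hc y))
      (fun x => negMulLog_nonneg (hp.pos x y).le (hp.le_one x y))
      (fun x => negMulLog_le_one (hp.pos x y))
  · exact Measurable.lintegral_prod_right' (f := fun z : F × E =>
      ENNReal.ofReal (negMulLog (p z.2 z.1)))
      (hnm.comp (hpm.comp measurable_swap)).ennreal_ofReal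

/-- Weak convergence makes the output densities converge at every `y`, and `klFun` is continuous and
nonnegative, so Fatou's lemma applies. -/
lemma IsChannelDensity.outGap_le_liminf (hp : IsChannelDensity vol p)
    (hc : ∀ y, Continuous fun x => p x y) {ℓ : F → ℝ} (hℓ : Measurable ℓ)
    {μs : ℕ → ProbabilityMeasure E}
    {μ : ProbabilityMeasure E} (h : Tendsto μs atTop (𝓝 μ)) :
    outGap vol p ℓ μ ≤ liminf (fun n => outGap vol p ℓ (μs n)) atTop := by
  refine le_trans (lintegral_mono fun y => ?_) (lintegral_liminf_le fun n => ?_)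
  · refine le_of_eq (Tendsto.liminf_eq ?_).symm
    refine ENNReal.tendsto_ofReal (Tendsto.const_mul _ ?_)
    refine (continuous_klFun.tendsto _).comp (Tendsto.mul_const _ ?_)
    exact tendsto_integral_of_bounded h (hc y) (C := 1)
      (fun x => by rw [abs_of_pos (hp.pos x y)]; exact hp.le_one x y)
  · have := hp.measurable_outDensity (μs n : Measure E)
    fun_prop

/-- The mutual information attains its maximum over input laws of bounded average cost. -/
theorem IsChannelDensity.exists_isMaxOn_divergence [T2Space E] [BorelSpace E]
    [TopologicalSpace.MetrizableSpace E] [TopologicalSpace.SeparableSpace E] [SigmaFinite vol]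
    (hp : IsChannelDensity vol p) (hc : ∀ y, Continuous fun x => p x y)
    {ℓ : F → ℝ} (hℓ : Measurable ℓ) (hℓ0 : ∀ y, 0 ≤ ℓ y)
    (hZ : ∫⁻ y, ENNReal.ofReal (exp (-ℓ y)) ∂vol ≠ ∞)
    {f c : E → ℝ} (hf : Continuous f) (hf0 : ∀ x, 0 ≤ f x)
    (hfℓ : ∀ x, ∫⁻ y, ENNReal.ofReal (p x y) * ENNReal.ofReal (ℓ y) ∂vol = ENNReal.ofReal (f x))
    (hcost : Continuous c) (hcost0 : ∀ x, 0 ≤ c x) (hcompact : ∀ R, IsCompact {x | c x ≤ R})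
    {A : ℝ} (hA : 0 ≤ A) (hfc : ∀ x, f x ^ 2 ≤ A * (1 + c x)) {B : ℝ≥0∞} (hB : B ≠ ∞)
    (hne : ∃ μ : ProbabilityMeasure E, ∫⁻ x, ENNReal.ofReal (c x) ∂(μ : Measure E) ≤ B) :
    ∃ μ : ProbabilityMeasure E, ∫⁻ x, ENNReal.ofReal (c x) ∂(μ : Measure E) ≤ B ∧
      ∀ ν : ProbabilityMeasure E, ∫⁻ x, ENNReal.ofReal (c x) ∂(ν : Measure E) ≤ B →
        divergence vol p ν ≤ divergence vol p μ := by
  let S : Set (ProbabilityMeasure E) := {μ | ∫⁻ x, ENNReal.ofReal (c x) ∂(μ : Measure E) ≤ B}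
  let D : ProbabilityMeasure E → ℝ≥0∞ := fun μ => divergence vol p μ
  let Z := ∫⁻ y, ENNReal.ofReal (exp (-ℓ y)) ∂vol
  have hsq : ∀ μ ∈ S, ∫⁻ x, ENNReal.ofReal (f x ^ 2) ∂(μ : Measure E) ≤
      ENNReal.ofReal A * (1 + B) := by
    intro μ hμ
    calc ∫⁻ x, ENNReal.ofReal (f x ^ 2) ∂(μ : Measure E)
        ≤ ∫⁻ x, ENNReal.ofReal A * (1 + ENNReal.ofReal (c x)) ∂(μ : Measure E) := by
          refine lintegral_mono fun x => (ENNReal.ofReal_le_ofReal (hfc x)).trans ?_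
          rw [ENNReal.ofReal_mul hA, ENNReal.ofReal_add zero_le_one (hcost0 x)]
          simp
      _ = ENNReal.ofReal A * (1 + ∫⁻ x, ENNReal.ofReal (c x) ∂(μ : Measure E)) := by
          have hcm := hcost.measurable
          rw [lintegral_const_mul _ (by fun_prop), lintegral_add_left measurable_const]
          simp
      _ ≤ _ := by gcongr; exact hμ
  -- Eliminating the output entropy between the two identities leaves `D` plus lower semicontinuous
  -- terms equal to a constant plus a linear functional.
  have hid : ∀ μ : ProbabilityMeasure E, D μ + (condEntropy vol p μ + outGap vol p ℓ μ + 1) =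
      Z + ∫⁻ x, ENNReal.ofReal (f x) ∂(μ : Measure E) := by
    intro μ
    simp_rw [← hfℓ]
    rw [← hp.outEntropy_add_outGap (μ : Measure E) hℓ hℓ0,
      ← hp.divergence_add_condEntropy (μ : Measure E)]
    simp only [D, add_assoc]
  -- Markov's inequality on the compact sublevel sets of `c`; by Prokhorov a maximising sequence
  -- then has a convergent subsequence.
  have htight : IsTightMeasureSet {((μ : ProbabilityMeasure E) : Measure E) | μ ∈ S} := by
    rw [isTightMeasureSet_iff_exists_isCompact_measure_compl_le]
    intro ε hε
    obtain ⟨k, hk⟩ : ∃ k : ℕ, B / ENNReal.ofReal (k + 1 : ℝ) ≤ ε := by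
      have ht : Tendsto (fun k : ℕ => B / ENNReal.ofReal (k + 1 : ℝ)) atTop (𝓝 (B / ∞)) := by
        refine ENNReal.Tendsto.const_div ?_ (Or.inr hB)
        exact ENNReal.tendsto_ofReal_atTop.comp
          (tendsto_natCast_atTop_atTop.atTop_add tendsto_const_nhds)
      rw [ENNReal.div_top] at ht
      obtain ⟨k, hk⟩ := (ht.eventually (gt_mem_nhds hε)).exists
      exact ⟨k, hk.le⟩
    refine ⟨{x | c x ≤ k + 1}, hcompact _, ?_⟩
    rintro _ ⟨μ, hμ, rfl⟩
    refine le_trans ?_ hk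
    have hcm := hcost.measurable
    refine le_trans (measure_mono ?_) ((meas_ge_le_lintegral_div
      (f := fun x => ENNReal.ofReal (c x)) (by fun_prop)
      (by simp; positivity) ENNReal.ofReal_ne_top).trans (ENNReal.div_le_div_right hμ _))
    intro x hx
    simp only [Set.mem_compl_iff, Set.mem_ofPred_eq, not_le] at hx ⊢
    exact ENNReal.ofReal_le_ofReal hx.le
  have hSne : (D '' S).Nonempty := Set.Nonempty.image _ hne
  obtain ⟨u, -, hu, huS⟩ := exists_seq_tendsto_sSup hSne (OrderTop.bddAbove _)
  choose μs hμS hμu using huS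
  let _ := TopologicalSpace.metrizableSpaceMetric E
  obtain ⟨μ, -, φ, hφ, hlim⟩ := (isCompact_closure_of_isTightMeasureSet htight).tendsto_subseq
    (fun n => subset_closure (hμS n))
  -- Cost may escape to infinity in the limit, so only a constraint in the form of an inequality is
  -- sure to survive.
  have hμ : μ ∈ S := by
    refine (lintegral_le_liminf_of_tendsto hlim hcost hcost0).trans ?_
    exact liminf_le_of_le (by isBoundedDefault) fun b hb => by
      obtain ⟨n, hn⟩ := hb.exists
      exact hn.trans (hμS _)
  refine ⟨μ, hμ, fun ν hν => (le_sSup (Set.mem_image_of_mem D (show ν ∈ S from hν))).trans ?_⟩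
  let R : ProbabilityMeasure E → ℝ≥0∞ := fun μ => condEntropy vol p μ + outGap vol p ℓ μ + 1
  have hRlim : R μ ≤ liminf (fun n => R (μs (φ n))) atTop := by
    have h1 := hp.condEntropy_le_liminf hc hlim
    have h2 := hp.outGap_le_liminf hc hℓ hlim
    calc R μ ≤ liminf (fun n => condEntropy vol p (μs (φ n))) atTop +
          liminf (fun n => outGap vol p ℓ (μs (φ n))) atTop +
          liminf (fun _ : ℕ => (1 : ℝ≥0∞)) atTop := by
          simp only [R, liminf_const]; gcongr <;> assumption
      _ ≤ _ := by
          refine le_trans ?_ (liminf_add_liminf_le _ _)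
          gcongr
          exact liminf_add_liminf_le _ _
  have hfin : ∫⁻ x, ENNReal.ofReal (f x) ∂(μ : Measure E) ≠ ∞ := by
    refine ne_top_of_le_ne_top (b := 1 + ENNReal.ofReal A * (1 + B)) (by finiteness) ?_
    calc ∫⁻ x, ENNReal.ofReal (f x) ∂(μ : Measure E)
        ≤ ∫⁻ x, (1 + ENNReal.ofReal (f x ^ 2)) ∂(μ : Measure E) := by
          refine lintegral_mono fun x => ?_
          rw [← ENNReal.ofReal_one, ← ENNReal.ofReal_add zero_le_one (by positivity)]
          exact ENNReal.ofReal_le_ofReal (by nlinarith [sq_nonneg (f x - 1)])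
      _ = 1 + ∫⁻ x, ENNReal.ofReal (f x ^ 2) ∂(μ : Measure E) := by
          rw [lintegral_add_left measurable_const]; simp
      _ ≤ _ := by gcongr; exact hsq μ hμ
  -- Finiteness is needed only at the limit law, where `R μ` is cancelled from the final chain.
  have hRfin : R μ ≠ ∞ := by
    refine ne_top_of_le_ne_top (ENNReal.add_ne_top.2 ⟨hZ, hfin⟩) ?_
    rw [← hid μ]; exact le_add_self
  rw [← ENNReal.add_le_add_iff_right hRfin]
  have hDlim : liminf (fun n => D (μs (φ n))) atTop = sSup (D '' S) := by
    refine Tendsto.liminf_eq ?_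
    simp_rw [hμu]
    exact hu.comp hφ.tendsto_atTop
  calc sSup (D '' S) + R μ
      ≤ liminf (fun n => D (μs (φ n))) atTop + liminf (fun n => R (μs (φ n))) atTop := by
        rw [hDlim]; gcongr
    _ ≤ liminf (fun n => D (μs (φ n)) + R (μs (φ n))) atTop := liminf_add_liminf_le _ _
    _ = liminf (fun n => Z + ∫⁻ x, ENNReal.ofReal (f x) ∂(μs (φ n) : Measure E)) atTop := by
        simp_rw [R, hid]
    _ ≤ limsup (fun n => Z + ∫⁻ x, ENNReal.ofReal (f x) ∂(μs (φ n) : Measure E)) atTop :=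
        liminf_le_limsup
    _ = Z + limsup (fun n => ∫⁻ x, ENNReal.ofReal (f x) ∂(μs (φ n) : Measure E)) atTop :=
        limsup_const_add _ _ _ (by isBoundedDefault) (by isBoundedDefault)
    _ ≤ Z + ∫⁻ x, ENNReal.ofReal (f x) ∂(μ : Measure E) := by
        gcongr
        exact limsup_lintegral_le_of_sq_bounded hlim hf hf0 (by finiteness)
          (fun n => hsq _ (hμS _))
    _ = D μ + R μ := (hid μ).symm

end Topological

end Channel

/-! ### Gaussian matrices and their densities -/

section Gaussian

instance {m n : ℕ} : BorelSpace (Matrix (Fin m) (Fin n) ℂ) :=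
  inferInstanceAs (BorelSpace (Fin m → Fin n → ℂ))

instance {m n : ℕ} : SecondCountableTopology (Matrix (Fin m) (Fin n) ℂ) :=
  inferInstanceAs (SecondCountableTopology (Fin m → Fin n → ℂ))

instance {m n : ℕ} : TopologicalSpace.MetrizableSpace (Matrix (Fin m) (Fin n) ℂ) :=
  inferInstanceAs (TopologicalSpace.MetrizableSpace (Fin m → Fin n → ℂ))

instance {m n : ℕ} : LocallyCompactSpace (Matrix (Fin m) (Fin n) ℂ) :=
  inferInstanceAs (LocallyCompactSpace (Fin m → Fin n → ℂ))

/-- Lebesgue measure on complex matrices. -/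
noncomputable def matrixVolume (m n : ℕ) : Measure (Matrix (Fin m) (Fin n) ℂ) :=
  (volume : Measure (Fin m → Fin n → ℂ))

instance {m n : ℕ} : (matrixVolume m n).IsAddHaarMeasure :=
  have : Measure.IsAddHaarMeasure (volume : Measure (Fin n → ℂ)) :=
    Measure.pi.isAddHaarMeasure fun _ => volume
  Measure.pi.isAddHaarMeasure fun _ : Fin m => (volume : Measure (Fin n → ℂ))

instance {m n : ℕ} : SigmaFinite (matrixVolume m n) :=
  inferInstanceAs (SigmaFinite (volume : Measure (Fin m → Fin n → ℂ)))

instance (v : ℝ≥0) : IsProbabilityMeasure (complexGaussian v) :=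
  Measure.isProbabilityMeasure_map
    (Complex.measurableEquivRealProd.symm.measurable).aemeasurable

lemma measurable_matrix_of {m n : ℕ} :
    Measurable (fun A : Fin m → Fin n → ℂ => Matrix.of A) := measurable_id

instance {m n : ℕ} (v : Fin m → Fin n → ℝ≥0) : IsProbabilityMeasure (gaussianMatrix v) :=
  Measure.isProbabilityMeasure_map measurable_matrix_of.aemeasurable

lemma gaussianMatrix_eq_pi {m n : ℕ} (v : Fin m → Fin n → ℝ≥0) :
    gaussianMatrix v = (Measure.pi fun i => Measure.pi fun j => complexGaussian (v i j) :
      Measure (Fin m → Fin n → ℂ)) := Measure.map_id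

/-- A product measure is determined by its values on boxes, where the integral of a product of
one-variable functions factors. -/
lemma pi_withDensity_ofReal {ι X : Type*} [Fintype ι] [MeasurableSpace X] {μ : ι → Measure X}
    [∀ i, SigmaFinite (μ i)] {f : ι → X → ℝ} (hf : ∀ i, Integrable (f i) (μ i))
    (h0 : ∀ i x, 0 ≤ f i x) :
    Measure.pi (fun i => (μ i).withDensity fun x => ENNReal.ofReal (f i x)) =
      (Measure.pi μ).withDensity fun x => ENNReal.ofReal (∏ i, f i (x i)) := by
  have : ∀ i, SigmaFinite ((μ i).withDensity fun x => ENNReal.ofReal (f i x)) := fun i =>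
    SigmaFinite.withDensity_ofReal _
  refine Measure.pi_eq fun s hs => ?_
  rw [withDensity_apply _ (MeasurableSet.univ_pi hs), Measure.restrict_pi_pi]
  rw [← ofReal_integral_eq_lintegral_ofReal
    (Integrable.fintype_prod fun i => (hf i).restrict)
    (ae_of_all _ fun x => Finset.prod_nonneg fun i _ => h0 i _),
    integral_fintype_prod_eq_prod, ENNReal.ofReal_prod_of_nonneg
      (fun i _ => integral_nonneg (h0 i))]
  refine Finset.prod_congr rfl fun i _ => ?_
  rw [withDensity_apply _ (hs i),
    ofReal_integral_eq_lintegral_ofReal (hf i).restrict (ae_of_all _ (h0 i))]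

/-- The density of `CN(0, 1)`. -/
noncomputable def complexGaussianDensity (z : ℂ) : ℝ := π⁻¹ * exp (-‖z‖ ^ 2)

lemma complexGaussianDensity_pos (z : ℂ) : 0 < complexGaussianDensity z := by
  unfold complexGaussianDensity; positivity

/-- The peak `1 / π` is below one. This is the source of the nonnegativity of all differential
entropies used here. -/
lemma complexGaussianDensity_le_one (z : ℂ) : complexGaussianDensity z ≤ 1 := by
  unfold complexGaussianDensity
  have h1 : π⁻¹ ≤ 1 := inv_le_one_of_one_le₀ (by linarith [pi_gt_three])
  have h2 : exp (-‖z‖ ^ 2) ≤ 1 := exp_le_one_iff.2 (by simp)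
  have := pi_pos
  exact mul_le_one₀ h1 (exp_pos _).le h2

lemma continuous_complexGaussianDensity : Continuous complexGaussianDensity := by
  unfold complexGaussianDensity; fun_prop

lemma complexGaussian_one : complexGaussian 1 =
    (volume : Measure ℂ).withDensity fun z => ENNReal.ofReal (complexGaussianDensity z) := by
  have hm : Measurable fun p : ℝ × ℝ => (⟨p.1, p.2⟩ : ℂ) :=
    Complex.measurableEquivRealProd.symm.measurable
  have hc := continuous_complexGaussianDensity.measurable
  refine Measure.ext_of_lintegral _ fun f hf => ?_
  have h2 : (1 / 2 : ℝ≥0) ≠ 0 := by simp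
  rw [complexGaussian, lintegral_map hf hm, gaussianReal_of_var_ne_zero _ h2,
    prod_withDensity (measurable_gaussianPDF _ _) (measurable_gaussianPDF _ _),
    lintegral_withDensity_eq_lintegral_mul _ (by fun_prop) (by fun_prop),
    lintegral_withDensity_eq_lintegral_mul _ (by fun_prop) hf,
    ← (Complex.volume_preserving_equiv_real_prod.symm).lintegral_comp (by fun_prop)]
  refine lintegral_congr fun p => ?_
  simp only [Pi.mul_apply, gaussianPDF]
  change _ = ENNReal.ofReal (complexGaussianDensity ⟨p.1, p.2⟩) * f ⟨p.1, p.2⟩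
  congr 1
  rw [← ENNReal.ofReal_mul (gaussianPDFReal_nonneg _ _ _)]
  congr 1
  simp only [gaussianPDFReal, complexGaussianDensity, Complex.sq_norm, Complex.normSq_mk]
  -- Each real component has variance `1 / 2`, so the two normalisations `1 / √π` multiply to `1 /
  -- π`.
  have h3 : (2 * π * ((1 / 2 : ℝ≥0) : ℝ)) = π := by push_cast; ring
  have h4 : (2 * ((1 / 2 : ℝ≥0) : ℝ)) = 1 := by push_cast; ring
  rw [h3, h4, mul_mul_mul_comm, ← exp_add, ← mul_inv, mul_self_sqrt pi_pos.le]
  congr 2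
  ring

/-- The density of a matrix with i.i.d. `CN(0, 1)` entries. -/
noncomputable def noiseDensity {m n : ℕ} (w : Matrix (Fin m) (Fin n) ℂ) : ℝ :=
  ∏ i, ∏ j, complexGaussianDensity (w i j)

variable {m n : ℕ}

lemma noiseDensity_pos (w : Matrix (Fin m) (Fin n) ℂ) : 0 < noiseDensity w :=
  Finset.prod_pos fun _ _ => Finset.prod_pos fun _ _ => complexGaussianDensity_pos _

lemma noiseDensity_le_one (w : Matrix (Fin m) (Fin n) ℂ) : noiseDensity w ≤ 1 :=
  Finset.prod_le_one (fun _ _ => Finset.prod_nonneg fun _ _ => (complexGaussianDensity_pos _).le)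
    fun _ _ => Finset.prod_le_one (fun _ _ => (complexGaussianDensity_pos _).le)
      fun _ _ => complexGaussianDensity_le_one _

lemma continuous_noiseDensity :
    Continuous (noiseDensity : Matrix (Fin m) (Fin n) ℂ → ℝ) := by
  refine continuous_finsetProd _ fun i _ => continuous_finsetProd _ fun j _ => ?_
  exact continuous_complexGaussianDensity.comp (continuous_id.matrix_elem i j)

lemma noiseDensity_eq (w : Matrix (Fin m) (Fin n) ℂ) :
    noiseDensity w = (π⁻¹) ^ (m * n) * exp (-∑ i, ∑ j, ‖w i j‖ ^ 2) := by
  simp only [noiseDensity, complexGaussianDensity, Finset.prod_mul_distrib, ← exp_sum,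
    Finset.sum_neg_distrib, Finset.prod_const, Finset.card_univ, Fintype.card_fin]
  rw [← pow_mul, mul_comm n m]

lemma integrable_complexGaussianDensity : Integrable complexGaussianDensity := by
  refine ⟨continuous_complexGaussianDensity.measurable.aestronglyMeasurable, ?_⟩
  rw [hasFiniteIntegral_iff_ofReal (ae_of_all _ fun z => (complexGaussianDensity_pos z).le)]
  have : (complexGaussian 1) Set.univ = 1 := measure_univ
  rw [complexGaussian_one, withDensity_apply _ MeasurableSet.univ, Measure.restrict_univ] at this
  simp [this]

lemma gaussianMatrix_one : gaussianMatrix (fun (_ : Fin m) (_ : Fin n) => 1) =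
    (matrixVolume m n).withDensity fun w => ENNReal.ofReal (noiseDensity w) := by
  rw [gaussianMatrix_eq_pi]
  simp_rw [complexGaussian_one]
  rw [pi_withDensity_ofReal (fun _ : Fin n => integrable_complexGaussianDensity)
      (fun _ z => (complexGaussianDensity_pos z).le),
    pi_withDensity_ofReal
      (f := fun (_ : Fin m) (x : Fin n → ℂ) => ∏ j, complexGaussianDensity (x j))
      (fun _ => Integrable.fintype_prod fun _ => integrable_complexGaussianDensity)
      (fun _ x => Finset.prod_nonneg fun j _ => (complexGaussianDensity_pos (x j)).le)]
  rfl

lemma integrable_norm_complexGaussian (v : ℝ≥0) : Integrable (fun z : ℂ => ‖z‖)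
    (complexGaussian v) := by
  have hm : Measurable fun p : ℝ × ℝ => (⟨p.1, p.2⟩ : ℂ) :=
    Complex.measurableEquivRealProd.symm.measurable
  rw [complexGaussian, integrable_map_measure (by fun_prop) hm.aemeasurable]
  have h : Integrable (fun x : ℝ => |x|) (gaussianReal 0 (v / 2)) :=
    (memLp_one_iff_integrable.1 (memLp_id_gaussianReal 1)).abs
  refine Integrable.mono' ((h.comp_fst _).add (h.comp_snd _))
    (by fun_prop) (ae_of_all _ fun p => ?_)
  simpa using Complex.norm_le_abs_re_add_abs_im ⟨p.1, p.2⟩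

lemma integrable_norm_entry (v : Fin m → Fin n → ℝ≥0) (i : Fin m) (j : Fin n) :
    Integrable (fun A : Matrix (Fin m) (Fin n) ℂ => ‖A i j‖) (gaussianMatrix v) := by
  rw [gaussianMatrix_eq_pi]
  have h := integrable_comp_eval (μ := fun j => complexGaussian (v i j)) (i := j)
    (integrable_norm_complexGaussian (v i j))
  exact integrable_comp_eval (μ := fun i => Measure.pi fun j => complexGaussian (v i j)) (i := i) h

/-- The finiteness of Z for ℓ(y) = ∑ |y_ij|: the integral factors over entries, each reducing in
polar coordinates to the convergent integral for Γ(2). -/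
lemma lintegral_exp_neg_norm_ne_top :
    ∫⁻ w, ENNReal.ofReal (exp (-∑ i, ∑ j, ‖w i j‖)) ∂(matrixVolume m n) ≠ ∞ := by
  have h1 : Integrable (fun z : ℂ => exp (-‖z‖)) := by
    rw [integrable_fun_norm_addHaar (μ := volume) (f := fun r => exp (-r))]
    have := Real.GammaIntegral_convergent (s := 2) (by norm_num)
    refine this.congr_fun (fun x hx => ?_) measurableSet_Ioi
    simp only [Complex.finrank_real_complex, smul_eq_mul]
    norm_num
    ring
  have h2 : Integrable (fun w : Fin m → Fin n → ℂ => ∏ i, ∏ j, exp (-‖w i j‖)) :=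
    Integrable.fintype_prod fun _ => Integrable.fintype_prod fun _ => h1
  have h3 : ∀ w : Fin m → Fin n → ℂ,
      ∏ i, ∏ j, exp (-‖w i j‖) = exp (-∑ i, ∑ j, ‖w i j‖) := fun w => by
    simp only [← exp_sum, Finset.sum_neg_distrib]
  simp_rw [h3] at h2
  exact ((hasFiniteIntegral_iff_ofReal (ae_of_all _ fun _ => (exp_pos _).le)).1 h2.2).ne

end Gaussian

/-! ### The MIMO channel as an instance of the abstract channel -/

section Transition

variable {M N T : ℕ} (v : Fin N → Fin M → ℝ≥0)

/-- The conditional density of the output of the channel given its input. -/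
noncomputable def transitionDensity (x : Matrix (Fin M) (Fin T) ℂ) (y : Matrix (Fin N) (Fin T) ℂ) :
    ℝ := ∫ g, noiseDensity (y - g * x) ∂gaussianMatrix v

lemma integrable_noiseDensity (x : Matrix (Fin M) (Fin T) ℂ) (y : Matrix (Fin N) (Fin T) ℂ) :
    Integrable (fun g => noiseDensity (y - g * x)) (gaussianMatrix v) := by
  have hc := continuous_noiseDensity (m := N) (n := T)
  refine Integrable.of_bound (C := 1) ?_ (ae_of_all _ fun g => ?_)
  · exact (hc.comp (by fun_prop)).measurable.aestronglyMeasurable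
  · rw [norm_of_nonneg (noiseDensity_pos _).le]; exact noiseDensity_le_one _

lemma ofReal_transitionDensity (x : Matrix (Fin M) (Fin T) ℂ) (y : Matrix (Fin N) (Fin T) ℂ) :
    ENNReal.ofReal (transitionDensity v x y) =
      ∫⁻ g, ENNReal.ofReal (noiseDensity (y - g * x)) ∂gaussianMatrix v :=
  ofReal_integral_eq_lintegral_ofReal (integrable_noiseDensity v x y)
    (ae_of_all _ fun _ => (noiseDensity_pos _).le)

lemma continuous_transitionDensity (y : Matrix (Fin N) (Fin T) ℂ) :
    Continuous fun x => transitionDensity v x y := by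
  have hc := continuous_noiseDensity (m := N) (n := T)
  refine continuous_of_dominated (bound := fun _ => 1)
    (fun x => (integrable_noiseDensity v x y).aestronglyMeasurable)
    (fun x => ae_of_all _ fun g => ?_) (integrable_const _) (ae_of_all _ fun g => ?_)
  · rw [norm_of_nonneg (noiseDensity_pos _).le]; exact noiseDensity_le_one _
  · exact hc.comp (by fun_prop)

lemma measurable_transitionDensity : Measurable
    fun z : Matrix (Fin M) (Fin T) ℂ × Matrix (Fin N) (Fin T) ℂ =>
      transitionDensity v z.1 z.2 := by
  have hc := continuous_noiseDensity (m := N) (n := T)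
  have : StronglyMeasurable
      fun z : (Matrix (Fin M) (Fin T) ℂ × Matrix (Fin N) (Fin T) ℂ) × Matrix (Fin N) (Fin M) ℂ =>
        noiseDensity (z.1.2 - z.2 * z.1.1) :=
    (hc.comp (by fun_prop)).measurable.stronglyMeasurable
  exact this.integral_prod_right.measurable

lemma lintegral_gaussianMatrix_one {f : Matrix (Fin N) (Fin T) ℂ → ℝ≥0∞} (hf : Measurable f) :
    ∫⁻ w, f w ∂(gaussianMatrix fun _ _ => 1) =
      ∫⁻ w, ENNReal.ofReal (noiseDensity w) * f w ∂matrixVolume N T := by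
  rw [gaussianMatrix_one]
  exact lintegral_withDensity_eq_lintegral_mul _
    continuous_noiseDensity.measurable.ennreal_ofReal hf

lemma lintegral_gaussianMatrix_one_add {f : Matrix (Fin N) (Fin T) ℂ → ℝ≥0∞} (hf : Measurable f)
    (a : Matrix (Fin N) (Fin T) ℂ) :
    ∫⁻ w, f (a + w) ∂(gaussianMatrix fun _ _ => 1) =
      ∫⁻ y, ENNReal.ofReal (noiseDensity (y - a)) * f y ∂matrixVolume N T := by
  rw [lintegral_gaussianMatrix_one (f := fun w => f (a + w))
      (hf.comp (Continuous.measurable (by fun_prop))),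
    ← lintegral_add_left_eq_self (fun y => ENNReal.ofReal (noiseDensity (y - a)) * f y) a]
  simp only [add_sub_cancel_left]

/-- Conditionally on `G`, the output is the noise translated by `G x`; Tonelli then averages the
translated density over `G`. The density of the output, the joint law and the moments all follow
from this formula. -/
lemma lintegral_gaussianMatrix_prod (x : Matrix (Fin M) (Fin T) ℂ)
    {f : Matrix (Fin N) (Fin T) ℂ → ℝ≥0∞} (hf : Measurable f) :
    ∫⁻ q, f (q.1 * x + q.2) ∂(gaussianMatrix v).prod (gaussianMatrix fun _ _ => 1) =
      ∫⁻ y, ENNReal.ofReal (transitionDensity v x y) * f y ∂matrixVolume N T := by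
  have hc := (continuous_noiseDensity (m := N) (n := T)).measurable
  have hmul : Measurable fun q : Matrix (Fin N) (Fin M) ℂ × Matrix (Fin N) (Fin T) ℂ =>
      q.1 * x + q.2 :=
    Continuous.measurable (by fun_prop)
  have hsub : Measurable fun q : Matrix (Fin N) (Fin M) ℂ × Matrix (Fin N) (Fin T) ℂ =>
      q.2 - q.1 * x :=
    Continuous.measurable (by fun_prop)
  rw [lintegral_prod (fun q : Matrix (Fin N) (Fin M) ℂ × Matrix (Fin N) (Fin T) ℂ =>
    f (q.1 * x + q.2)) (hf.comp hmul).aemeasurable]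
  simp_rw [lintegral_gaussianMatrix_one_add hf]
  rw [lintegral_lintegral_swap
    (f := fun (g : Matrix (Fin N) (Fin M) ℂ) y => ENNReal.ofReal (noiseDensity (y - g * x)) * f y)]
  · refine lintegral_congr fun y => ?_
    rw [ofReal_transitionDensity, lintegral_mul_const]
    exact (hc.comp (hsub.comp measurable_prodMk_right)).ennreal_ofReal
  · exact ((hc.comp hsub).ennreal_ofReal.mul (hf.comp measurable_snd)).aemeasurable

lemma isChannelDensity_transitionDensity :
    IsChannelDensity (matrixVolume N T) (transitionDensity (T := T) v) where
  measurable := measurable_transitionDensity v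
  pos x y := by
    unfold transitionDensity
    rw [integral_pos_iff_support_of_nonneg (fun _ => (noiseDensity_pos _).le)
      (integrable_noiseDensity v x y)]
    have : Function.support (fun g : Matrix (Fin N) (Fin M) ℂ => noiseDensity (y - g * x)) =
        Set.univ := by
      ext g; simpa using (noiseDensity_pos _).ne'
    rw [this]
    simp
  le_one x y := by
    calc _ ≤ ∫ _, (1 : ℝ) ∂gaussianMatrix v :=
          integral_mono (integrable_noiseDensity v x y) (integrable_const _)
            fun _ => noiseDensity_le_one _
      _ = 1 := by simp
  lintegral_eq_one x := by
    have := lintegral_gaussianMatrix_prod (T := T) v x (f := fun _ => 1) measurable_const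
    simpa using this.symm

lemma measurable_channel : Measurable fun p : Matrix (Fin M) (Fin T) ℂ ×
    (Matrix (Fin N) (Fin M) ℂ × Matrix (Fin N) (Fin T) ℂ) => (p.1, p.2.1 * p.1 + p.2.2) :=
  Continuous.measurable (by fun_prop)

lemma jointLaw_eq_withDensity (μ : Measure (Matrix (Fin M) (Fin T) ℂ)) [SFinite μ] :
    jointLaw v μ = (μ.prod (matrixVolume N T)).withDensity
      fun z => ENNReal.ofReal (transitionDensity v z.1 z.2) := by
  have hp := measurable_transitionDensity (T := T) v
  refine Measure.ext_of_lintegral _ fun f hf => ?_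
  rw [jointLaw, lintegral_map hf measurable_channel,
    lintegral_prod (fun p : Matrix (Fin M) (Fin T) ℂ ×
      (Matrix (Fin N) (Fin M) ℂ × Matrix (Fin N) (Fin T) ℂ) => f (p.1, p.2.1 * p.1 + p.2.2))
      (hf.comp measurable_channel).aemeasurable,
    lintegral_withDensity_eq_lintegral_mul _ (by fun_prop) hf,
    lintegral_prod _ (by fun_prop)]
  refine lintegral_congr fun x => ?_
  exact lintegral_gaussianMatrix_prod v x (f := fun y => f (x, y))
    (hf.comp measurable_prodMk_left)

instance (μ : Measure (Matrix (Fin M) (Fin T) ℂ)) [IsProbabilityMeasure μ] :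
    IsProbabilityMeasure (jointLaw v μ) :=
  Measure.isProbabilityMeasure_map measurable_channel.aemeasurable

lemma jointLaw_fst (μ : Measure (Matrix (Fin M) (Fin T) ℂ)) [SFinite μ] :
    (jointLaw v μ).fst = μ := by
  rw [Measure.fst, jointLaw, Measure.map_map measurable_fst measurable_channel]
  exact Measure.fst_prod

lemma jointLaw_snd (μ : Measure (Matrix (Fin M) (Fin T) ℂ)) [IsProbabilityMeasure μ] :
    (jointLaw v μ).snd = (matrixVolume N T).withDensity
      fun y => ENNReal.ofReal (outDensity (transitionDensity v) μ y) := by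
  have hp := measurable_transitionDensity (T := T) v
  have hd := isChannelDensity_transitionDensity (T := T) v
  have hq := hd.measurable_outDensity μ
  refine Measure.ext_of_lintegral _ fun f hf => ?_
  rw [Measure.snd, lintegral_map hf measurable_snd, jointLaw_eq_withDensity,
    lintegral_withDensity_eq_lintegral_mul _ (by fun_prop) (by fun_prop),
    lintegral_withDensity_eq_lintegral_mul _ (by fun_prop) hf,
    lintegral_prod_symm _ (by fun_prop)]
  refine lintegral_congr fun y => ?_
  simp only [Pi.mul_apply]
  rw [lintegral_mul_const _ (hd.measurable_left y).ennreal_ofReal, hd.ofReal_outDensity μ]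

lemma mutualInfo_eq_divergence (μ : Measure (Matrix (Fin M) (Fin T) ℂ)) [IsProbabilityMeasure μ] :
    mutualInfo v μ = divergence (matrixVolume N T) (transitionDensity v) μ /
      ENNReal.ofReal (Real.log 2) := by
  rw [mutualInfo, jointLaw_fst, jointLaw_snd, jointLaw_eq_withDensity, divergence]

/-- The expected sum of the moduli of the output entries given the input. -/
noncomputable def expectedOutput (x : Matrix (Fin M) (Fin T) ℂ) : ℝ :=
  ∫ q : Matrix (Fin N) (Fin M) ℂ × Matrix (Fin N) (Fin T) ℂ,
    ∑ i, ∑ j, ‖(q.1 * x + q.2) i j‖ ∂(gaussianMatrix v).prod (gaussianMatrix fun _ _ => 1)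

lemma norm_mul_apply_le {l : ℕ} (g : Matrix (Fin l) (Fin M) ℂ) (x : Matrix (Fin M) (Fin T) ℂ)
    (i : Fin l) (j : Fin T) : ‖(g * x) i j‖ ≤ ∑ k, ‖g i k‖ * ‖x k j‖ := by
  rw [Matrix.mul_apply]
  exact (norm_sum_le _ _).trans (le_of_eq (by simp))

lemma measurable_entry {m n : ℕ} (i : Fin m) (j : Fin n) :
    Measurable fun A : Matrix (Fin m) (Fin n) ℂ => A i j :=
  (continuous_id.matrix_elem i j).measurable

lemma integrable_output_entry (x : Matrix (Fin M) (Fin T) ℂ) (i : Fin N) (j : Fin T) :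
    Integrable (fun q : Matrix (Fin N) (Fin M) ℂ × Matrix (Fin N) (Fin T) ℂ =>
      ‖(q.1 * x + q.2) i j‖) ((gaussianMatrix v).prod (gaussianMatrix fun _ _ => 1)) := by
  have hb : Integrable (fun q : Matrix (Fin N) (Fin M) ℂ × Matrix (Fin N) (Fin T) ℂ =>
      ∑ k, ‖q.1 i k‖ * ‖x k j‖ + ‖q.2 i j‖)
      ((gaussianMatrix v).prod (gaussianMatrix fun _ _ => 1)) :=
    (integrable_finsetSum _ fun k _ =>
      ((integrable_norm_entry v i k).comp_fst _).mul_const _).add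
      ((integrable_norm_entry (fun _ _ => 1) i j).comp_snd _)
  have hc : Continuous fun q : Matrix (Fin N) (Fin M) ℂ × Matrix (Fin N) (Fin T) ℂ =>
      ‖(q.1 * x + q.2) i j‖ :=
    Continuous.norm (Continuous.matrix_elem (by fun_prop) i j)
  refine hb.mono' hc.measurable.aestronglyMeasurable (ae_of_all _ fun q => ?_)
  rw [norm_norm]
  exact (norm_add_le _ _).trans (add_le_add_left (norm_mul_apply_le _ _ _ _) _)

lemma lintegral_transitionDensity_mul_norm (x : Matrix (Fin M) (Fin T) ℂ) :
    ∫⁻ y, ENNReal.ofReal (transitionDensity v x y) * ENNReal.ofReal (∑ i, ∑ j, ‖y i j‖)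
      ∂matrixVolume N T = ENNReal.ofReal (expectedOutput v x) := by
  have hm : Measurable fun y : Matrix (Fin N) (Fin T) ℂ => ∑ i, ∑ j, ‖y i j‖ :=
    Finset.measurable_sum _ fun i _ => Finset.measurable_sum _ fun j _ =>
      (measurable_entry i j).norm
  rw [← lintegral_gaussianMatrix_prod v x (f := fun y => ENNReal.ofReal (∑ i, ∑ j, ‖y i j‖))
    hm.ennreal_ofReal, expectedOutput, ofReal_integral_eq_lintegral_ofReal]
  · exact integrable_finsetSum _ fun i _ => integrable_finsetSum _ fun j _ =>
      integrable_output_entry v x i j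
  · exact ae_of_all _ fun q => Finset.sum_nonneg fun i _ => Finset.sum_nonneg fun j _ =>
      norm_nonneg _

lemma expectedOutput_nonneg (x : Matrix (Fin M) (Fin T) ℂ) : 0 ≤ expectedOutput v x :=
  integral_nonneg fun _ => Finset.sum_nonneg fun _ _ => Finset.sum_nonneg fun _ _ => norm_nonneg _

/-- The expected output is Lipschitz in the input. -/
lemma expectedOutput_le_add (x x' : Matrix (Fin M) (Fin T) ℂ) :
    expectedOutput v x ≤ expectedOutput v x' +
      ∑ i, ∑ j, ∑ k, (∫ g, ‖g i k‖ ∂gaussianMatrix v) * ‖(x - x') k j‖ := by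
  have hI : ∀ i k, Integrable (fun q : Matrix (Fin N) (Fin M) ℂ × Matrix (Fin N) (Fin T) ℂ =>
      ‖q.1 i k‖) ((gaussianMatrix v).prod (gaussianMatrix fun _ _ => 1)) :=
    fun i k => (integrable_norm_entry v i k).comp_fst _
  have hE : ∀ i k, ∫ g, ‖g i k‖ ∂gaussianMatrix v =
      ∫ q : Matrix (Fin N) (Fin M) ℂ × Matrix (Fin N) (Fin T) ℂ, ‖q.1 i k‖
        ∂(gaussianMatrix v).prod (gaussianMatrix fun _ _ => 1) := by
    intro i k
    have := integral_fun_fst (μ := gaussianMatrix v)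
      (ν := gaussianMatrix fun (_ : Fin N) (_ : Fin T) => 1) (fun g => ‖g i k‖)
    simp [this]
  unfold expectedOutput
  simp_rw [hE, ← integral_mul_const]
  rw [integral_finsetSum _ fun i _ => integrable_finsetSum _ fun j _ =>
      integrable_output_entry v x i j,
    integral_finsetSum _ fun i _ => integrable_finsetSum _ fun j _ =>
      integrable_output_entry v x' i j, ← Finset.sum_add_distrib]
  refine Finset.sum_le_sum fun i _ => ?_
  rw [integral_finsetSum _ fun j _ => integrable_output_entry v x i j,
    integral_finsetSum _ fun j _ => integrable_output_entry v x' i j, ← Finset.sum_add_distrib]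
  refine Finset.sum_le_sum fun j _ => ?_
  rw [← integral_finsetSum _ fun k _ => (hI i k).mul_const _,
    ← integral_add (integrable_output_entry v x' i j)
      (integrable_finsetSum _ fun k _ => (hI i k).mul_const _)]
  refine integral_mono (integrable_output_entry v x i j)
    ((integrable_output_entry v x' i j).add
      (integrable_finsetSum _ fun k _ => (hI i k).mul_const _)) fun q => ?_
  have h1 : (q.1 * x + q.2) i j = (q.1 * x' + q.2) i j + (q.1 * (x - x')) i j := by
    rw [Matrix.mul_sub]; simp only [Matrix.add_apply, Matrix.sub_apply]; ring
  dsimp only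
  rw [h1]
  exact (norm_add_le _ _).trans (add_le_add_right (norm_mul_apply_le _ _ _ _) _)

lemma continuous_expectedOutput : Continuous (expectedOutput (T := T) v) := by
  rw [continuous_iff_continuousAt]
  intro x'
  let d : Matrix (Fin M) (Fin T) ℂ → ℝ := fun x =>
    ∑ i, ∑ j, ∑ k, (∫ g, ‖g i k‖ ∂gaussianMatrix v) * ‖(x - x') k j‖
  have hd : Continuous d := by
    refine continuous_finsetSum _ fun i _ => continuous_finsetSum _ fun j _ =>
      continuous_finsetSum _ fun k _ => continuous_const.mul (Continuous.norm ?_)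
    exact Continuous.matrix_elem (by fun_prop) k j
  have hd0 : Tendsto d (𝓝 x') (𝓝 0) := by
    have := hd.tendsto x'
    simpa [d] using this
  rw [ContinuousAt, tendsto_iff_dist_tendsto_zero]
  refine squeeze_zero (fun _ => dist_nonneg) (fun x => ?_) hd0
  rw [Real.dist_eq, abs_le]
  have h1 := expectedOutput_le_add v x x'
  have h2 := expectedOutput_le_add v x' x
  have h3 : ∀ k j, ‖(x' - x) k j‖ = ‖(x - x') k j‖ := fun k j => by
    simp only [Matrix.sub_apply]; exact norm_sub_rev _ _
  simp_rw [h3] at h2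
  constructor <;> simp only [d] <;> linarith

/-- The squared Frobenius norm. -/
noncomputable def frobSq {m n : ℕ} (x : Matrix (Fin m) (Fin n) ℂ) : ℝ := ∑ i, ∑ j, ‖x i j‖ ^ 2

lemma frobSq_nonneg {m n : ℕ} (x : Matrix (Fin m) (Fin n) ℂ) : 0 ≤ frobSq x :=
  Finset.sum_nonneg fun _ _ => Finset.sum_nonneg fun _ _ => by positivity

lemma continuous_frobSq {m n : ℕ} : Continuous (frobSq (m := m) (n := n)) :=
  continuous_finsetSum _ fun i _ => continuous_finsetSum _ fun j _ =>
    ((continuous_id.matrix_elem i j).norm).pow 2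

lemma norm_entry_le_sqrt_frobSq {m n : ℕ} (x : Matrix (Fin m) (Fin n) ℂ) (i : Fin m) (j : Fin n) :
    ‖x i j‖ ≤ √(frobSq x) := by
  refine le_sqrt_of_sq_le ?_
  calc ‖x i j‖ ^ 2 ≤ ∑ j, ‖x i j‖ ^ 2 :=
        Finset.single_le_sum (f := fun j => ‖x i j‖ ^ 2) (fun _ _ => by positivity)
          (Finset.mem_univ j)
    _ ≤ _ := Finset.single_le_sum (f := fun i => ∑ j, ‖x i j‖ ^ 2)
          (fun _ _ => Finset.sum_nonneg fun _ _ => by positivity) (Finset.mem_univ i)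

lemma isCompact_frobSq_le {m n : ℕ} (R : ℝ) :
    IsCompact {x : Matrix (Fin m) (Fin n) ℂ | frobSq x ≤ R} := by
  have h : IsCompact (Set.univ.pi fun _ : Fin m => Set.univ.pi fun _ : Fin n =>
      Metric.closedBall (0 : ℂ) √R) :=
    isCompact_univ_pi fun _ => isCompact_univ_pi fun _ => isCompact_closedBall _ _
  refine IsCompact.of_isClosed_subset (s := Set.univ.pi fun _ : Fin m => Set.univ.pi
    fun _ : Fin n => Metric.closedBall (0 : ℂ) √R) h
    (isClosed_le continuous_frobSq continuous_const) fun x hx => ?_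
  intro i _ j _
  rw [mem_closedBall_zero_iff]
  exact (norm_entry_le_sqrt_frobSq x i j).trans (sqrt_le_sqrt hx)

/-- Comparison with the zero input bounds the expected output by `b + a √(frobSq x)`, and `(b + t)²
≤ 2 b² + 2 t²`. A power bound thus controls second moments of the expected output, giving the
uniform integrability used in the limit. -/
lemma exists_expectedOutput_sq_le : ∃ A, 0 ≤ A ∧
    ∀ x : Matrix (Fin M) (Fin T) ℂ, expectedOutput v x ^ 2 ≤ A * (1 + frobSq x) := by
  set b := expectedOutput v (0 : Matrix (Fin M) (Fin T) ℂ)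
  set a := ∑ i, ∑ _j : Fin T, ∑ k, (∫ g, ‖g i k‖ ∂gaussianMatrix v)
  have hb : 0 ≤ b := expectedOutput_nonneg v _
  have hint : ∀ i k, 0 ≤ ∫ g, ‖g i k‖ ∂gaussianMatrix v := fun i k =>
    integral_nonneg fun _ => norm_nonneg _
  have ha : 0 ≤ a := Finset.sum_nonneg fun i _ => Finset.sum_nonneg fun j _ =>
    Finset.sum_nonneg fun k _ => hint i k
  refine ⟨2 * b ^ 2 + 2 * a ^ 2, by positivity, fun x => ?_⟩
  have h0 := frobSq_nonneg x
  have h1 : expectedOutput v x ≤ b + a * √(frobSq x) := by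
    refine (expectedOutput_le_add v x 0).trans ?_
    gcongr
    simp only [a, Finset.sum_mul, sub_zero]
    gcongr with i _ j _ k _
    · exact norm_entry_le_sqrt_frobSq x k j
  have h2 : expectedOutput v x ^ 2 ≤ (b + a * √(frobSq x)) ^ 2 :=
    pow_le_pow_left₀ (expectedOutput_nonneg v x) h1 2
  have h3 : √(frobSq x) ^ 2 = frobSq x := sq_sqrt h0
  nlinarith [sq_nonneg (b - a * √(frobSq x)), mul_nonneg (sq_nonneg b) h0, sq_nonneg a]

end Transition

/-! ### Stability of Gaussian laws -/

section Stable

variable {X : Type*} [MeasurableSpace X] [AddCommGroup X] [Module ℝ X]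

/-- `b ξ + s ξ'` has law `μ` when `ξ` and `ξ'` are independent of law `μ`. -/
def IsStableUnder (b s : ℝ) (μ : Measure X) : Prop :=
  (μ.prod μ).map (fun p => b • p.1 + s • p.2) = μ

variable {b s : ℝ}

lemma isStableUnder_gaussianReal (h : b ^ 2 + s ^ 2 = 1) (v : ℝ≥0) :
    IsStableUnder b s (gaussianReal 0 v) := by
  have h1 : ((gaussianReal 0 v).prod (gaussianReal 0 v)).map (Prod.map (b * ·) (s * ·)) =
      ((gaussianReal 0 v).map (b * ·)).prod ((gaussianReal 0 v).map (s * ·)) :=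
    (Measure.map_prod_map _ _ (by fun_prop) (by fun_prop)).symm
  have h2 := gaussianReal_conv_gaussianReal (m₁ := b * 0) (m₂ := s * 0)
    (v₁ := .mk (b ^ 2) (sq_nonneg _) * v) (v₂ := .mk (s ^ 2) (sq_nonneg _) * v)
  rw [← gaussianReal_map_const_mul, ← gaussianReal_map_const_mul, Measure.conv, ← h1,
    Measure.map_map (by fun_prop) (by fun_prop)] at h2
  rw [IsStableUnder]
  refine Eq.trans h2 ?_
  congr 1
  · simp
  · rw [← add_mul]
    have : (NNReal.mk (b ^ 2) (sq_nonneg _) + NNReal.mk (s ^ 2) (sq_nonneg _) : ℝ≥0) = 1 := by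
      ext; simpa using h
    rw [this, one_mul]

lemma IsStableUnder.map {Y : Type*} [MeasurableSpace Y] [AddCommGroup Y] [Module ℝ Y]
    {μ : Measure X} [SFinite μ] (hμ : IsStableUnder b s μ) {f : X → Y} (hf : Measurable f)
    (hlin : ∀ x y, f (b • x + s • y) = b • f x + s • f y)
    (hX : Measurable fun p : X × X => b • p.1 + s • p.2)
    (hY : Measurable fun p : Y × Y => b • p.1 + s • p.2) : IsStableUnder b s (μ.map f) := by
  rw [IsStableUnder, Measure.map_prod_map _ _ hf hf, Measure.map_map hY (hf.prodMap hf)]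
  conv_rhs => rw [← hμ, Measure.map_map hf hX]
  congr 1
  ext p
  exact (hlin _ _).symm

lemma IsStableUnder.pi {ι : Type*} [Fintype ι] {μ : ι → Measure X}
    [∀ i, IsProbabilityMeasure (μ i)] (hμ : ∀ i, IsStableUnder b s (μ i))
    (hX : Measurable fun p : X × X => b • p.1 + s • p.2) :
    IsStableUnder b s (Measure.pi μ) := by
  have h1 := (measurePreserving_arrowProdEquivProdArrow X X ι μ μ).map_eq
  have hY : Measurable fun p : (ι → X) × (ι → X) => b • p.1 + s • p.2 := by
    refine measurable_pi_lambda _ fun i => ?_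
    have h : Measurable fun p : (ι → X) × (ι → X) => (p.1 i, p.2 i) := by fun_prop
    exact hX.comp h
  rw [IsStableUnder, ← h1, Measure.map_map hY (MeasurableEquiv.measurable _)]
  have h2 := Measure.pi_map_pi (μ := fun i => (μ i).prod (μ i))
    (f := fun _ p => b • p.1 + s • p.2) (fun i => hX.aemeasurable)
  have h3 : ∀ i, ((μ i).prod (μ i)).map (fun p => b • p.1 + s • p.2) = μ i := hμ
  simp_rw [h3] at h2
  exact h2

lemma isStableUnder_complexGaussian (h : b ^ 2 + s ^ 2 = 1) (v : ℝ≥0) :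
    IsStableUnder b s (complexGaussian v) := by
  have h1 := ((measurePreserving_finTwoArrow (gaussianReal 0 (v / 2)))).map_eq
  have hm : Measurable fun p : ℝ × ℝ => (⟨p.1, p.2⟩ : ℂ) :=
    Complex.measurableEquivRealProd.symm.measurable
  rw [complexGaussian, ← h1, Measure.map_map hm (MeasurableEquiv.measurable _)]
  refine IsStableUnder.map (IsStableUnder.pi (fun _ => isStableUnder_gaussianReal h _)
    (by fun_prop)) (hm.comp (MeasurableEquiv.measurable _)) (fun x y => ?_)
    (by fun_prop) (by fun_prop)
  apply Complex.ext <;> simp [MeasurableEquiv.finTwoArrow]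

lemma isStableUnder_gaussianMatrix {m n : ℕ} (h : b ^ 2 + s ^ 2 = 1) (v : Fin m → Fin n → ℝ≥0) :
    IsStableUnder b s (gaussianMatrix v) := by
  rw [gaussianMatrix_eq_pi]
  exact IsStableUnder.pi (fun i => IsStableUnder.pi
    (fun j => isStableUnder_complexGaussian h _) (by fun_prop)) (by fun_prop)

end Stable

/-! ### Amplification and data processing -/

section Scaling

variable {M N T : ℕ} (v : Fin N → Fin M → ℝ≥0)

lemma lintegral_jointLaw (μ : Measure (Matrix (Fin M) (Fin T) ℂ)) [SFinite μ]
    {f : Matrix (Fin M) (Fin T) ℂ × Matrix (Fin N) (Fin T) ℂ → ℝ≥0∞} (hf : Measurable f) :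
    ∫⁻ z, f z ∂jointLaw v μ = ∫⁻ x, ∫⁻ g, ∫⁻ w, f (x, g * x + w)
      ∂(gaussianMatrix fun _ _ => 1) ∂gaussianMatrix v ∂μ := by
  rw [jointLaw, lintegral_map hf measurable_channel,
    lintegral_prod (fun p : Matrix (Fin M) (Fin T) ℂ ×
      (Matrix (Fin N) (Fin M) ℂ × Matrix (Fin N) (Fin T) ℂ) => f (p.1, p.2.1 * p.1 + p.2.2))
      (hf.comp measurable_channel).aemeasurable]
  refine lintegral_congr fun x => ?_
  exact lintegral_prod (fun q : Matrix (Fin N) (Fin M) ℂ × Matrix (Fin N) (Fin T) ℂ =>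
    f (x, q.1 * x + q.2)) ((hf.comp measurable_channel).comp measurable_prodMk_left).aemeasurable

lemma klDiv_prod_left {X Y : Type*} [MeasurableSpace X] [MeasurableSpace Y] (μ ν : Measure X)
    (ρ : Measure Y) [IsFiniteMeasure μ] [IsFiniteMeasure ν] [IsProbabilityMeasure ρ] :
    InformationTheory.klDiv (μ.prod ρ) (ν.prod ρ) = InformationTheory.klDiv μ ν := by
  rw [← Measure.compProd_const, ← Measure.compProd_const, InformationTheory.klDiv_compProd_left]

/-- Amplifying the input does not decrease the mutual information. -/
lemma mutualInfo_le_mutualInfo_smul (μ : Measure (Matrix (Fin M) (Fin T) ℂ))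
    [IsProbabilityMeasure μ] {a : ℝ} (ha : 1 ≤ a) :
    mutualInfo v μ ≤ mutualInfo v (μ.map fun x => a • x) := by
  have ha0 : a ≠ 0 := by positivity
  have hsm : Measurable fun x : Matrix (Fin M) (Fin T) ℂ => a • x :=
    Continuous.measurable (by fun_prop)
  have : IsProbabilityMeasure (μ.map fun x => a • x) :=
    Measure.isProbabilityMeasure_map hsm.aemeasurable
  set b := a⁻¹
  set s := √(1 - b ^ 2)
  have hb1 : b ^ 2 ≤ 1 := pow_le_one₀ (by positivity) (inv_le_one_of_one_le₀ ha)
  -- Attenuating the amplified output by `b = 1 / a` shrinks its noise to variance `b²`; fresh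
  -- independent noise scaled by `s` restores variance one. The original channel is thus a degraded
  -- version of the amplified one.
  have hbs : b ^ 2 + s ^ 2 = 1 := by rw [sq_sqrt (by linarith)]; ring
  let W := gaussianMatrix fun (_ : Fin N) (_ : Fin T) => 1
  let Ja := jointLaw v (μ.map fun x => a • x)
  let F : (Matrix (Fin M) (Fin T) ℂ × Matrix (Fin N) (Fin T) ℂ) × Matrix (Fin N) (Fin T) ℂ →
    Matrix (Fin M) (Fin T) ℂ × Matrix (Fin N) (Fin T) ℂ :=
    fun z => (b • z.1.1, b • z.1.2 + s • z.2)
  have hF : Measurable F := Continuous.measurable (by fun_prop)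
  have hmix : Measurable fun p : Matrix (Fin N) (Fin T) ℂ × Matrix (Fin N) (Fin T) ℂ =>
      b • p.1 + s • p.2 := Continuous.measurable (by fun_prop)
  have hbm : Measurable fun x : Matrix (Fin M) (Fin T) ℂ => b • x :=
    Continuous.measurable (by fun_prop)
  have hst : (W.prod W).map (fun p => b • p.1 + s • p.2) = W :=
    isStableUnder_gaussianMatrix hbs _
  have hJ : jointLaw v μ = (Ja.prod W).map F := by
    refine Measure.ext_of_lintegral _ fun f hf => ?_
    rw [lintegral_map hf hF, lintegral_prod (fun z => f (F z)) (hf.comp hF).aemeasurable,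
      lintegral_jointLaw v μ hf]
    have hin : Measurable fun z : Matrix (Fin M) (Fin T) ℂ × Matrix (Fin N) (Fin T) ℂ =>
        ∫⁻ w, f (F (z, w)) ∂W := (hf.comp hF).lintegral_prod_right'
    rw [lintegral_jointLaw v _ hin, lintegral_map _ hsm]
    · refine lintegral_congr fun x => lintegral_congr fun g => ?_
      have hfx : Measurable fun w : Matrix (Fin N) (Fin T) ℂ => f (x, g * x + w) :=
        hf.comp (Continuous.measurable (by fun_prop))
      change ∫⁻ w, f (x, g * x + w) ∂W = _
      conv_lhs => rw [← hst]
      rw [lintegral_map hfx hmix, lintegral_prod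
        (fun p : Matrix (Fin N) (Fin T) ℂ × Matrix (Fin N) (Fin T) ℂ =>
          f (x, g * x + (b • p.1 + s • p.2))) (hfx.comp hmix).aemeasurable]
      refine lintegral_congr fun w => lintegral_congr fun w' => ?_
      simp only [F]
      rw [smul_add, Matrix.mul_smul, smul_smul, smul_smul, inv_mul_cancel₀ ha0, one_smul,
        one_smul, add_assoc]
    · have h1 : Measurable fun q : (Matrix (Fin M) (Fin T) ℂ × Matrix (Fin N) (Fin M) ℂ) ×
          Matrix (Fin N) (Fin T) ℂ => (q.1.1, q.1.2 * q.1.1 + q.2) :=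
        Continuous.measurable (by fun_prop)
      exact ((hin.comp h1).lintegral_prod_right' (ν := W)).lintegral_prod_right'
        (ν := gaussianMatrix v)
  have hfst : (jointLaw v μ).fst = Ja.fst.map fun x => b • x := by
    have h1 : (Ja.prod W).map Prod.fst = Ja := Measure.fst_prod
    rw [Measure.fst, Measure.fst, hJ, Measure.map_map measurable_fst hF,
      Measure.map_map hbm measurable_fst]
    conv_rhs => rw [← h1, Measure.map_map (hbm.comp measurable_fst) measurable_fst]
    rfl
  have hsnd : (jointLaw v μ).snd = (Ja.snd.prod W).map fun p => b • p.1 + s • p.2 := by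
    have h1 : (Ja.prod W).map (Prod.map Prod.snd id) = Ja.snd.prod W := by
      rw [← Measure.map_prod_map _ _ measurable_snd measurable_id, Measure.map_id]; rfl
    rw [← h1, Measure.map_map hmix (measurable_snd.prodMap measurable_id), Measure.snd, hJ,
      Measure.map_map measurable_snd hF]
    rfl
  -- The same map `F` carries the product of the amplified marginals, with fresh noise adjoined, to
  -- the product of the original marginals, so data processing applies to the pair.
  have hprod : (jointLaw v μ).fst.prod (jointLaw v μ).snd =
      ((Ja.fst.prod Ja.snd).prod W).map F := by
    have h1 : ((Ja.fst.prod Ja.snd).prod W).map MeasurableEquiv.prodAssoc =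
      Ja.fst.prod (Ja.snd.prod W) := Measure.prodAssoc_prod
    rw [hfst, hsnd, Measure.map_prod_map _ _ hbm hmix, ← h1,
      Measure.map_map (hbm.prodMap hmix) (MeasurableEquiv.measurable _)]
    rfl
  refine ENNReal.div_le_div_right ?_ _
  rw [hprod, hJ]
  refine (InformationTheory.klDiv_map_le _ _ hF).trans (le_of_eq ?_)
  exact klDiv_prod_left _ _ _

end Scaling

/-! ### Attainment of the capacity -/

section Maximiser

variable {M N T : ℕ} (v : Fin N → Fin M → ℝ≥0)

lemma avgPower_eq (μ : Measure (Matrix (Fin M) (Fin T) ℂ)) :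
    avgPower μ = (∫⁻ x, ENNReal.ofReal (frobSq x) ∂μ) / ((M : ℝ≥0∞) * (T : ℝ≥0∞)) := by
  rw [avgPower]
  congr 1
  have hm : ∀ (i : Fin M) (j : Fin T),
      Measurable fun x : Matrix (Fin M) (Fin T) ℂ => ‖x i j‖ₑ ^ 2 :=
    fun i j => (measurable_entry i j).enorm.pow_const 2
  have h : ∀ x : Matrix (Fin M) (Fin T) ℂ,
      ENNReal.ofReal (frobSq x) = ∑ i, ∑ j, ‖x i j‖ₑ ^ 2 := fun x => by
    rw [frobSq, ENNReal.ofReal_sum_of_nonneg fun i _ => Finset.sum_nonneg fun j _ => by positivity]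
    refine Finset.sum_congr rfl fun i _ => ?_
    rw [ENNReal.ofReal_sum_of_nonneg fun j _ => by positivity]
    refine Finset.sum_congr rfl fun j _ => ?_
    rw [ENNReal.ofReal_pow (norm_nonneg _), ofReal_norm]
  simp_rw [h]
  rw [lintegral_finsetSum _ fun i _ => Finset.measurable_sum _ fun j _ => hm i j]
  refine Finset.sum_congr rfl fun i _ => ?_
  rw [lintegral_finsetSum _ fun j _ => hm i j]

lemma avgPower_eq_one_iff (hM : 0 < M) (hT : 0 < T) (μ : Measure (Matrix (Fin M) (Fin T) ℂ)) :
    avgPower μ = 1 ↔ ∫⁻ x, ENNReal.ofReal (frobSq x) ∂μ = (M : ℝ≥0∞) * (T : ℝ≥0∞) := by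
  rw [avgPower_eq, ENNReal.div_eq_one_iff (by positivity) (by finiteness)]

/-- A zero input makes the joint law a product. This settles the one case in which no rescaling can
restore the power. -/
lemma divergence_eq_zero_of_ae_eq_zero (μ : Measure (Matrix (Fin M) (Fin T) ℂ))
    [IsProbabilityMeasure μ] (h : ∀ᵐ x ∂μ, x = 0) :
    divergence (matrixVolume N T) (transitionDensity v) μ = 0 := by
  have hd := isChannelDensity_transitionDensity (T := T) v
  have hq := hd.measurable_outDensity μ
  have : IsFiniteMeasure ((matrixVolume N T).withDensity
      fun y => ENNReal.ofReal (outDensity (transitionDensity v) μ y)) :=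
    isFiniteMeasure_withDensity (by rw [hd.lintegral_outDensity μ]; simp)
  have h0 : ∀ y, outDensity (transitionDensity v) μ y = transitionDensity (T := T) v 0 y := by
    intro y
    rw [outDensity, integral_congr_ae (g := fun _ => transitionDensity v 0 y)]
    · simp
    · filter_upwards [h] with x hx
      rw [hx]
  have h1 : (μ.prod (matrixVolume N T)).withDensity
      (fun z => ENNReal.ofReal (transitionDensity v z.1 z.2)) =
      μ.prod ((matrixVolume N T).withDensity
        fun y => ENNReal.ofReal (outDensity (transitionDensity v) μ y)) := by
    rw [prod_withDensity_right (by fun_prop)]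
    refine withDensity_congr_ae ?_
    filter_upwards [Measure.quasiMeasurePreserving_fst.ae h] with z hz
    rw [hz, h0]
  rw [divergence, h1, InformationTheory.klDiv_self]

lemma frobSq_smul (a : ℝ) (x : Matrix (Fin M) (Fin T) ℂ) : frobSq (a • x) = a ^ 2 * frobSq x := by
  simp only [frobSq, Finset.mul_sum, Matrix.smul_apply, norm_smul, mul_pow, norm_eq_abs, sq_abs]

lemma frobSq_eq_zero {x : Matrix (Fin M) (Fin T) ℂ} (h : frobSq x = 0) : x = 0 := by
  ext i j
  have := norm_entry_le_sqrt_frobSq x i j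
  rw [h, sqrt_zero, norm_le_zero_iff] at this
  simpa using this

lemma exists_avgPower_eq_one_mutualInfo_eq_capacity (hM : 0 < M) (hT : 0 < T) :
    ∃ μ : Measure (Matrix (Fin M) (Fin T) ℂ), IsProbabilityMeasure μ ∧ avgPower μ = 1 ∧
      mutualInfo v μ = capacity T v := by
  have hd := isChannelDensity_transitionDensity (T := T) v
  have hcont := continuous_frobSq (m := M) (n := T)
  obtain ⟨A, hA, hfc⟩ := exists_expectedOutput_sq_le (T := T) v
  set B : ℝ≥0∞ := (M : ℝ≥0∞) * (T : ℝ≥0∞)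
  have hBt : B ≠ ∞ := by finiteness
  have hone : avgPower (Measure.dirac (Matrix.of fun _ _ => 1 : Matrix (Fin M) (Fin T) ℂ)) = 1 := by
    rw [avgPower_eq_one_iff hM hT, lintegral_dirac' _ hcont.measurable.ennreal_ofReal]
    simp [frobSq, ENNReal.ofReal_mul]
  obtain ⟨⟨μ, hμp⟩, hμ, hmax⟩ := hd.exists_isMaxOn_divergence (B := B)
    (continuous_transitionDensity v)
    (ℓ := fun y => ∑ i, ∑ j, ‖y i j‖)
    (Finset.measurable_sum _ fun i _ => Finset.measurable_sum _ fun j _ =>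
      (measurable_entry i j).norm)
    (fun y => Finset.sum_nonneg fun _ _ => Finset.sum_nonneg fun _ _ => norm_nonneg _)
    lintegral_exp_neg_norm_ne_top (continuous_expectedOutput v) (expectedOutput_nonneg v)
    (lintegral_transitionDensity_mul_norm v) hcont frobSq_nonneg isCompact_frobSq_le hA hfc hBt
    ⟨⟨Measure.dirac _, inferInstance⟩, ((avgPower_eq_one_iff hM hT _).1 hone).le⟩
  simp only [ProbabilityMeasure.coe_mk] at hμ hmax
  have hcap : capacity T v ≤ mutualInfo v μ := by
    refine iSup_le fun ν => iSup_le fun hν => iSup_le fun hν1 => ?_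
    rw [mutualInfo_eq_divergence, mutualInfo_eq_divergence]
    exact ENNReal.div_le_div_right
      (hmax ⟨ν, hν⟩ ((avgPower_eq_one_iff hM hT _).1 hν1).le) _
  suffices h : ∃ ν : Measure (Matrix (Fin M) (Fin T) ℂ), IsProbabilityMeasure ν ∧ avgPower ν = 1 ∧
      mutualInfo v μ ≤ mutualInfo v ν by
    obtain ⟨ν, hν, hν1, hle⟩ := h
    exact ⟨ν, hν, hν1, le_antisymm (le_iSup_of_le ν (le_iSup_of_le hν (le_iSup_of_le hν1 le_rfl)))
      (hcap.trans hle)⟩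
  -- The maximiser is known only to have power at most the budget. At zero power it carries no
  -- information and the all-ones input does at least as well; otherwise it is amplified to full
  -- power.
  by_cases h0 : ∫⁻ x, ENNReal.ofReal (frobSq x) ∂μ = 0
  · refine ⟨_, inferInstance, hone, ?_⟩
    rw [mutualInfo_eq_divergence, divergence_eq_zero_of_ae_eq_zero, ENNReal.zero_div]
    · exact zero_le
    · rw [lintegral_eq_zero_iff hcont.measurable.ennreal_ofReal] at h0
      filter_upwards [h0] with x hx
      refine frobSq_eq_zero (le_antisymm ?_ (frobSq_nonneg x))
      simpa using hx
  · set P := ∫⁻ x, ENNReal.ofReal (frobSq x) ∂μ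
    have hPt : P ≠ ∞ := ne_top_of_le_ne_top hBt hμ
    have hq : B / P ≠ ∞ := ENNReal.div_ne_top hBt h0
    set a := √(B / P).toReal
    have ha : 1 ≤ a := by
      refine one_le_sqrt.2 ?_
      rw [← ENNReal.toReal_one]
      exact ENNReal.toReal_mono hq ((ENNReal.le_div_iff_mul_le (Or.inl h0) (Or.inl hPt)).2
        (by rwa [one_mul]))
    have hsm : Measurable fun x : Matrix (Fin M) (Fin T) ℂ => a • x :=
      Continuous.measurable (by fun_prop)
    refine ⟨_, Measure.isProbabilityMeasure_map hsm.aemeasurable, ?_,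
      mutualInfo_le_mutualInfo_smul v μ ha⟩
    rw [avgPower_eq_one_iff hM hT, lintegral_map hcont.measurable.ennreal_ofReal hsm]
    simp_rw [frobSq_smul, ENNReal.ofReal_mul (sq_nonneg a)]
    rw [lintegral_const_mul _ hcont.measurable.ennreal_ofReal, sq_sqrt ENNReal.toReal_nonneg,
      ENNReal.ofReal_toReal hq, ENNReal.div_mul_cancel h0 hPt]

end Maximiser

/-! ### Isotropic inputs and concavity of entropy -/

section Unitary

variable {M N T : ℕ}

instance : CompactSpace (Matrix.unitaryGroup (Fin T) ℂ) := by
  refine isCompact_iff_compactSpace.1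
    (?_ : IsCompact (Matrix.unitaryGroup (Fin T) ℂ : Set (Matrix (Fin T) (Fin T) ℂ)))
  refine IsCompact.of_isClosed_subset (isCompact_frobSq_le (m := T) (n := T) (T * T)) ?_ ?_
  · have : (Matrix.unitaryGroup (Fin T) ℂ : Set (Matrix (Fin T) (Fin T) ℂ)) =
        {A | A * star A = 1} := by
      ext A; exact Matrix.mem_unitaryGroup_iff
    rw [this]
    exact isClosed_eq (by fun_prop) continuous_const
  · intro U hU
    have h : ∀ i j, ‖U i j‖ ^ 2 ≤ 1 := fun i j =>
      pow_le_one₀ (norm_nonneg _) (entry_norm_bound_of_unitary hU i j)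
    calc frobSq U ≤ ∑ _i : Fin T, ∑ _j : Fin T, (1 : ℝ) :=
          Finset.sum_le_sum fun i _ => Finset.sum_le_sum fun j _ => h i j
      _ = _ := by simp

/-- The isotropic distribution on the unitary group. -/
noncomputable def unitaryHaar (T : ℕ) : Measure (Matrix.unitaryGroup (Fin T) ℂ) :=
  Measure.haarMeasure ⊤

instance : (unitaryHaar T).IsHaarMeasure :=
  inferInstanceAs (Measure.IsHaarMeasure (Measure.haarMeasure ⊤))

instance : IsProbabilityMeasure (unitaryHaar T) :=
  ⟨Measure.haarMeasure_self
    (K₀ := (⊤ : TopologicalSpace.PositiveCompacts (Matrix.unitaryGroup (Fin T) ℂ)))⟩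

lemma coe_mul_coe_inv (U : Matrix.unitaryGroup (Fin T) ℂ) :
    (U : Matrix (Fin T) (Fin T) ℂ) *
      ((U⁻¹ : Matrix.unitaryGroup (Fin T) ℂ) : Matrix (Fin T) (Fin T) ℂ) = 1 := by
  rw [← Matrix.UnitaryGroup.mul_val, mul_inv_cancel]; rfl

lemma coe_inv_mul_coe (U : Matrix.unitaryGroup (Fin T) ℂ) :
    ((U⁻¹ : Matrix.unitaryGroup (Fin T) ℂ) : Matrix (Fin T) (Fin T) ℂ) * U = 1 := by
  rw [← Matrix.UnitaryGroup.mul_val, inv_mul_cancel]; rfl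

lemma mul_coe_mul_coe_inv (x : Matrix (Fin M) (Fin T) ℂ) (U : Matrix.unitaryGroup (Fin T) ℂ) :
    x * (U : Matrix (Fin T) (Fin T) ℂ) *
      ((U⁻¹ : Matrix.unitaryGroup (Fin T) ℂ) : Matrix (Fin T) (Fin T) ℂ) = x := by
  rw [Matrix.mul_assoc, coe_mul_coe_inv, Matrix.mul_one]

lemma mul_coe_inv_mul_coe (x : Matrix (Fin M) (Fin T) ℂ) (U : Matrix.unitaryGroup (Fin T) ℂ) :
    x * ((U⁻¹ : Matrix.unitaryGroup (Fin T) ℂ) : Matrix (Fin T) (Fin T) ℂ) *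
      (U : Matrix (Fin T) (Fin T) ℂ) = x := by
  rw [Matrix.mul_assoc, coe_inv_mul_coe, Matrix.mul_one]

lemma frobSq_eq_trace (x : Matrix (Fin M) (Fin T) ℂ) :
    (frobSq x : ℂ) = (x * x.conjTranspose).trace := by
  simp [frobSq, Matrix.trace, Matrix.mul_apply, Complex.mul_conj']

lemma frobSq_mul_unitary (x : Matrix (Fin M) (Fin T) ℂ) (U : Matrix.unitaryGroup (Fin T) ℂ) :
    frobSq (x * (U : Matrix (Fin T) (Fin T) ℂ)) = frobSq x := by
  have hU : (U : Matrix (Fin T) (Fin T) ℂ) * (U : Matrix (Fin T) (Fin T) ℂ).conjTranspose = 1 :=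
    Matrix.mem_unitaryGroup_iff.1 U.2
  have : (frobSq (x * (U : Matrix (Fin T) (Fin T) ℂ)) : ℂ) = frobSq x := by
    rw [frobSq_eq_trace, frobSq_eq_trace, Matrix.conjTranspose_mul, Matrix.mul_assoc,
      ← Matrix.mul_assoc (U : Matrix (Fin T) (Fin T) ℂ), hU, Matrix.one_mul]
  exact_mod_cast this

lemma noiseDensity_mul_unitary (w : Matrix (Fin N) (Fin T) ℂ)
    (U : Matrix.unitaryGroup (Fin T) ℂ) :
    noiseDensity (w * (U : Matrix (Fin T) (Fin T) ℂ)) = noiseDensity w := by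
  have := frobSq_mul_unitary w U
  unfold frobSq at this
  rw [noiseDensity_eq, noiseDensity_eq, this]

lemma measurable_mul_unitary (U : Matrix.unitaryGroup (Fin T) ℂ) :
    Measurable fun y : Matrix (Fin N) (Fin T) ℂ => y * (U : Matrix (Fin T) (Fin T) ℂ) :=
  Continuous.measurable (by fun_prop)

/-- The image is again a Haar measure, hence a multiple of Lebesgue measure. Integrating the
unitarily invariant noise density against both measures gives 1 each time, so the factor is one and
no determinant is needed. -/
lemma map_mul_unitary_matrixVolume (U : Matrix.unitaryGroup (Fin T) ℂ) :
    (matrixVolume N T).map (fun y => y * (U : Matrix (Fin T) (Fin T) ℂ)) = matrixVolume N T := by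
  let e : Matrix (Fin N) (Fin T) ℂ ≃+ Matrix (Fin N) (Fin T) ℂ :=
    { toFun := fun y => y * (U : Matrix (Fin T) (Fin T) ℂ)
      invFun := fun y => y * ((U⁻¹ : Matrix.unitaryGroup (Fin T) ℂ) : Matrix (Fin T) (Fin T) ℂ)
      left_inv := fun y => mul_coe_mul_coe_inv y U
      right_inv := fun y => mul_coe_inv_mul_coe y U
      map_add' := fun y z => Matrix.add_mul y z _ }
  have he : ((matrixVolume N T).map e).IsAddHaarMeasure :=
    e.isAddHaarMeasure_map _ (by
        change Continuous fun y : Matrix (Fin N) (Fin T) ℂ => y * (U : Matrix (Fin T) (Fin T) ℂ)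
        fun_prop)
      (by
        change Continuous fun y : Matrix (Fin N) (Fin T) ℂ =>
          y * ((U⁻¹ : Matrix.unitaryGroup (Fin T) ℂ) : Matrix (Fin T) (Fin T) ℂ)
        fun_prop)
  have hm := measurable_mul_unitary (N := N) U
  have hd := (continuous_noiseDensity (m := N) (n := T)).measurable.ennreal_ofReal
  have hone : ∫⁻ w, ENNReal.ofReal (noiseDensity w) ∂matrixVolume N T = 1 := by
    have := lintegral_gaussianMatrix_one (N := N) (T := T) (f := fun _ => 1) measurable_const
    simpa using this.symm
  have hc := Measure.isAddLeftInvariant_eq_smul ((matrixVolume N T).map e) (matrixVolume N T)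
  have h1 : ∫⁻ w, ENNReal.ofReal (noiseDensity w) ∂((matrixVolume N T).map e) = 1 := by
    change ∫⁻ w, ENNReal.ofReal (noiseDensity w)
      ∂((matrixVolume N T).map fun y => y * (U : Matrix (Fin T) (Fin T) ℂ)) = 1
    rw [lintegral_map hd hm]
    simp_rw [noiseDensity_mul_unitary, hone]
  rw [hc, lintegral_smul_measure, hone, ENNReal.smul_def, smul_eq_mul, mul_one] at h1
  change (matrixVolume N T).map e = _
  rw [hc]
  have h2 : ((matrixVolume N T).map e).addHaarScalarFactor (matrixVolume N T) = 1 := by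
    exact_mod_cast h1
  rw [h2, one_smul]

lemma lintegral_mul_unitary (U : Matrix.unitaryGroup (Fin T) ℂ)
    {f : Matrix (Fin N) (Fin T) ℂ → ℝ≥0∞} (hf : Measurable f) :
    ∫⁻ y, f (y * (U : Matrix (Fin T) (Fin T) ℂ)) ∂matrixVolume N T =
      ∫⁻ y, f y ∂matrixVolume N T := by
  conv_rhs => rw [← map_mul_unitary_matrixVolume U, lintegral_map hf (measurable_mul_unitary U)]

lemma transitionDensity_mul_unitary (v : Fin N → Fin M → ℝ≥0) (x : Matrix (Fin M) (Fin T) ℂ)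
    (y : Matrix (Fin N) (Fin T) ℂ) (U : Matrix.unitaryGroup (Fin T) ℂ) :
    transitionDensity v (x * (U : Matrix (Fin T) (Fin T) ℂ)) y =
      transitionDensity v x
        (y * ((U⁻¹ : Matrix.unitaryGroup (Fin T) ℂ) : Matrix (Fin T) (Fin T) ℂ)) := by
  unfold transitionDensity
  congr 1
  ext g
  conv_rhs => rw [← noiseDensity_mul_unitary _ U, Matrix.sub_mul, mul_coe_inv_mul_coe,
    Matrix.mul_assoc]

/-- The law of `X Q` for `X` of law `μ` and `Q` isotropic and independent of `X`. -/
noncomputable def isotropize (μ : Measure (Matrix (Fin M) (Fin T) ℂ)) :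
    Measure (Matrix (Fin M) (Fin T) ℂ) :=
  (μ.prod (unitaryHaar T)).map fun z => z.1 * (z.2 : Matrix (Fin T) (Fin T) ℂ)

lemma measurable_mul_coe : Measurable
    fun z : Matrix (Fin M) (Fin T) ℂ × Matrix.unitaryGroup (Fin T) ℂ =>
      z.1 * (z.2 : Matrix (Fin T) (Fin T) ℂ) :=
  Continuous.measurable (by fun_prop)

instance (μ : Measure (Matrix (Fin M) (Fin T) ℂ)) [IsProbabilityMeasure μ] :
    IsProbabilityMeasure (isotropize μ) :=
  Measure.isProbabilityMeasure_map measurable_mul_coe.aemeasurable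

lemma lintegral_isotropize (μ : Measure (Matrix (Fin M) (Fin T) ℂ)) [SFinite μ]
    {f : Matrix (Fin M) (Fin T) ℂ → ℝ≥0∞} (hf : Measurable f) :
    ∫⁻ x, f x ∂isotropize μ =
      ∫⁻ x, ∫⁻ U, f (x * (U : Matrix (Fin T) (Fin T) ℂ)) ∂unitaryHaar T ∂μ := by
  rw [isotropize, lintegral_map hf measurable_mul_coe]
  exact lintegral_prod (fun z : Matrix (Fin M) (Fin T) ℂ × Matrix.unitaryGroup (Fin T) ℂ =>
    f (z.1 * (z.2 : Matrix (Fin T) (Fin T) ℂ))) (hf.comp measurable_mul_coe).aemeasurable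

lemma avgPower_isotropize (μ : Measure (Matrix (Fin M) (Fin T) ℂ)) [SFinite μ] :
    avgPower (isotropize μ) = avgPower μ := by
  rw [avgPower_eq, avgPower_eq,
    lintegral_isotropize μ continuous_frobSq.measurable.ennreal_ofReal]
  simp [frobSq_mul_unitary]

variable (v : Fin N → Fin M → ℝ≥0) (μ : Measure (Matrix (Fin M) (Fin T) ℂ))
  [IsProbabilityMeasure μ]

lemma outDensity_isotropize (y : Matrix (Fin N) (Fin T) ℂ) :
    outDensity (transitionDensity v) (isotropize μ) y =
      ∫ U : Matrix.unitaryGroup (Fin T) ℂ, outDensity (transitionDensity v) μ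
        (y * ((U⁻¹ : Matrix.unitaryGroup (Fin T) ℂ) : Matrix (Fin T) (Fin T) ℂ))
          ∂unitaryHaar T := by
  have hd := isChannelDensity_transitionDensity (T := T) v
  have hm : Measurable fun z : Matrix (Fin M) (Fin T) ℂ × Matrix.unitaryGroup (Fin T) ℂ =>
      transitionDensity v (z.1 * (z.2 : Matrix (Fin T) (Fin T) ℂ)) y :=
    (hd.measurable_left y).comp measurable_mul_coe
  unfold outDensity
  rw [isotropize, integral_map measurable_mul_coe.aemeasurable
    (hd.measurable_left y).aestronglyMeasurable, integral_prod_symm]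
  · simp_rw [transitionDensity_mul_unitary]
  · refine Integrable.of_bound hm.aestronglyMeasurable 1 (ae_of_all _ fun z => ?_)
    rw [norm_of_nonneg (hd.pos _ _).le]
    exact hd.le_one _ _

lemma measurable_mul_coe_inv : Measurable
    fun z : Matrix (Fin N) (Fin T) ℂ × Matrix.unitaryGroup (Fin T) ℂ =>
      z.1 * ((z.2⁻¹ : Matrix.unitaryGroup (Fin T) ℂ) : Matrix (Fin T) (Fin T) ℂ) :=
  Continuous.measurable (by fun_prop)

/-- With the `y` integral taken first, `U` acts only on `y` and disappears by invariance of Lebesgue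
measure. -/
lemma lintegral_lintegral_isotropize
    {f : Matrix (Fin M) (Fin T) ℂ → Matrix (Fin N) (Fin T) ℂ → ℝ≥0∞}
    (hf : Measurable fun z : Matrix (Fin M) (Fin T) ℂ × Matrix (Fin N) (Fin T) ℂ => f z.1 z.2)
    (hU : ∀ x y (U : Matrix.unitaryGroup (Fin T) ℂ), f (x * (U : Matrix (Fin T) (Fin T) ℂ)) y =
      f x (y * ((U⁻¹ : Matrix.unitaryGroup (Fin T) ℂ) : Matrix (Fin T) (Fin T) ℂ))) :
    ∫⁻ y, ∫⁻ x, f x y ∂isotropize μ ∂matrixVolume N T =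
      ∫⁻ y, ∫⁻ x, f x y ∂μ ∂matrixVolume N T := by
  have hs : Measurable fun z : Matrix (Fin N) (Fin T) ℂ × Matrix (Fin M) (Fin T) ℂ => f z.2 z.1 :=
    hf.comp measurable_swap
  rw [lintegral_lintegral_swap (f := fun y x => f x y) hs.aemeasurable,
    lintegral_lintegral_swap (f := fun y x => f x y) hs.aemeasurable,
    lintegral_isotropize μ hf.lintegral_prod_right']
  refine lintegral_congr fun x => ?_
  have hx : Measurable (f x) := hf.comp (measurable_prodMk_left (x := x))
  simp_rw [hU, fun U : Matrix.unitaryGroup (Fin T) ℂ => lintegral_mul_unitary U⁻¹ hx]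
  simp

lemma condEntropy_isotropize :
    condEntropy (matrixVolume N T) (transitionDensity v) (isotropize μ) =
      condEntropy (matrixVolume N T) (transitionDensity v) μ := by
  have hd := isChannelDensity_transitionDensity (T := T) v
  refine lintegral_lintegral_isotropize μ
    (f := fun x y => ENNReal.ofReal (negMulLog (transitionDensity v x y)))
    (continuous_negMulLog.measurable.comp hd.measurable).ennreal_ofReal fun x y U => ?_
  rw [transitionDensity_mul_unitary]

/-- Jensen's inequality for the concave `negMulLog` on each orbit, followed by Tonelli and
invariance of Lebesgue measure. -/
lemma lintegral_negMulLog_le_lintegral_average {q : Matrix (Fin N) (Fin T) ℂ → ℝ}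
    (hq : Measurable q) (hq0 : ∀ y, 0 < q y) (hq1 : ∀ y, q y ≤ 1) :
    ∫⁻ y, ENNReal.ofReal (negMulLog (q y)) ∂matrixVolume N T ≤
      ∫⁻ y, ENNReal.ofReal (negMulLog (∫ U : Matrix.unitaryGroup (Fin T) ℂ,
        q (y * ((U⁻¹ : Matrix.unitaryGroup (Fin T) ℂ) : Matrix (Fin T) (Fin T) ℂ))
          ∂unitaryHaar T)) ∂matrixVolume N T := by
  have hn := continuous_negMulLog.measurable
  have hs : Measurable fun z : Matrix (Fin N) (Fin T) ℂ × Matrix.unitaryGroup (Fin T) ℂ =>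
      q (z.1 * ((z.2⁻¹ : Matrix.unitaryGroup (Fin T) ℂ) : Matrix (Fin T) (Fin T) ℂ)) :=
    hq.comp measurable_mul_coe_inv
  have h0 : ∀ z, 0 ≤ negMulLog (q z) := fun z => negMulLog_nonneg (hq0 z).le (hq1 z)
  have hJensen : ∀ y : Matrix (Fin N) (Fin T) ℂ,
      ∫⁻ U : Matrix.unitaryGroup (Fin T) ℂ, ENNReal.ofReal (negMulLog
        (q (y * ((U⁻¹ : Matrix.unitaryGroup (Fin T) ℂ) : Matrix (Fin T) (Fin T) ℂ))))
          ∂unitaryHaar T ≤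
      ENNReal.ofReal (negMulLog (∫ U : Matrix.unitaryGroup (Fin T) ℂ,
        q (y * ((U⁻¹ : Matrix.unitaryGroup (Fin T) ℂ) : Matrix (Fin T) (Fin T) ℂ))
          ∂unitaryHaar T)) := by
    intro y
    have hy : Measurable fun U : Matrix.unitaryGroup (Fin T) ℂ =>
        q (y * ((U⁻¹ : Matrix.unitaryGroup (Fin T) ℂ) : Matrix (Fin T) (Fin T) ℂ)) :=
      hs.comp measurable_prodMk_left
    have hi1 : Integrable (fun U : Matrix.unitaryGroup (Fin T) ℂ =>
        q (y * ((U⁻¹ : Matrix.unitaryGroup (Fin T) ℂ) : Matrix (Fin T) (Fin T) ℂ)))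
        (unitaryHaar T) :=
      Integrable.of_bound hy.aestronglyMeasurable 1 (ae_of_all _ fun U => by
        rw [norm_of_nonneg (hq0 _).le]; exact hq1 _)
    have hi2 : Integrable (fun U : Matrix.unitaryGroup (Fin T) ℂ => negMulLog
        (q (y * ((U⁻¹ : Matrix.unitaryGroup (Fin T) ℂ) : Matrix (Fin T) (Fin T) ℂ))))
        (unitaryHaar T) :=
      Integrable.of_bound (hn.comp hy).aestronglyMeasurable 1 (ae_of_all _ fun U => by
        rw [norm_of_nonneg (h0 _)]; exact negMulLog_le_one (hq0 _))
    rw [← ofReal_integral_eq_lintegral_ofReal hi2 (ae_of_all _ fun _ => h0 _)]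
    exact ENNReal.ofReal_le_ofReal (concaveOn_negMulLog.le_map_integral
      continuous_negMulLog.continuousOn isClosed_Ici (ae_of_all _ fun U => (hq0 _).le) hi1 hi2)
  refine le_trans (le_of_eq ?_) (lintegral_mono hJensen)
  have h1 := fun U : Matrix.unitaryGroup (Fin T) ℂ => lintegral_mul_unitary (N := N) U⁻¹
    (f := fun y => ENNReal.ofReal (negMulLog (q y))) (hn.comp hq).ennreal_ofReal
  rw [lintegral_lintegral_swap ((hn.comp hs).ennreal_ofReal.aemeasurable)]
  simp_rw [h1]
  simp

lemma outEntropy_le_outEntropy_isotropize :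
    outEntropy (matrixVolume N T) (transitionDensity v) μ ≤
      outEntropy (matrixVolume N T) (transitionDensity v) (isotropize μ) := by
  have hd := isChannelDensity_transitionDensity (T := T) v
  have h := lintegral_negMulLog_le_lintegral_average (hd.measurable_outDensity μ)
    (hd.outDensity_pos μ) (hd.outDensity_le_one μ)
  simp_rw [← outDensity_isotropize] at h
  exact h

/-- The chain h(Y|X) ≤ h(Y) ≤ Z + E f(X) is finite at finite power. This licenses cancelling h(Y|X)
when two mutual informations are compared. -/
lemma condEntropy_ne_top (h : ∫⁻ x, ENNReal.ofReal (frobSq x) ∂μ ≠ ∞) :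
    condEntropy (matrixVolume N T) (transitionDensity v) μ ≠ ∞ := by
  have hd := isChannelDensity_transitionDensity (T := T) v
  obtain ⟨A, hA, hfc⟩ := exists_expectedOutput_sq_le (T := T) v
  have hm := (continuous_frobSq (m := M) (n := T)).measurable.ennreal_ofReal
  have hid := hd.outEntropy_add_outGap μ (ℓ := fun y => ∑ i, ∑ j, ‖y i j‖)
    (Finset.measurable_sum _ fun i _ => Finset.measurable_sum _ fun j _ =>
      (measurable_entry i j).norm)
    (fun y => Finset.sum_nonneg fun _ _ => Finset.sum_nonneg fun _ _ => norm_nonneg _)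
  simp_rw [lintegral_transitionDensity_mul_norm] at hid
  have hfin : ∫⁻ x, ENNReal.ofReal (expectedOutput v x) ∂μ ≠ ∞ := by
    refine ne_top_of_le_ne_top (b := (1 + ENNReal.ofReal A) +
      ENNReal.ofReal A * ∫⁻ x, ENNReal.ofReal (frobSq x) ∂μ) (by finiteness) ?_
    calc ∫⁻ x, ENNReal.ofReal (expectedOutput v x) ∂μ
        ≤ ∫⁻ x, ((1 + ENNReal.ofReal A) + ENNReal.ofReal A * ENNReal.ofReal (frobSq x)) ∂μ := by
          refine lintegral_mono fun x => ?_
          have h0 := frobSq_nonneg x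
          rw [← ENNReal.ofReal_mul hA, ← ENNReal.ofReal_one, ← ENNReal.ofReal_add zero_le_one hA,
            ← ENNReal.ofReal_add (by positivity) (by positivity)]
          refine ENNReal.ofReal_le_ofReal ?_
          nlinarith [hfc x, sq_nonneg (expectedOutput v x - 1)]
      _ = _ := by
          rw [lintegral_add_left measurable_const, lintegral_const_mul _ hm]
          simp
  have hout : outEntropy (matrixVolume N T) (transitionDensity v) μ ≠ ∞ := by
    refine ne_top_of_le_ne_top (ENNReal.add_ne_top.2
      ⟨lintegral_exp_neg_norm_ne_top (m := N) (n := T), hfin⟩) ?_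
    rw [← hid, add_assoc]
    exact le_self_add
  refine ne_top_of_le_ne_top hout ?_
  rw [← hd.divergence_add_condEntropy μ]
  exact le_add_self

lemma mutualInfo_le_mutualInfo_isotropize (h : ∫⁻ x, ENNReal.ofReal (frobSq x) ∂μ ≠ ∞) :
    mutualInfo v μ ≤ mutualInfo v (isotropize μ) := by
  have hd := isChannelDensity_transitionDensity (T := T) v
  rw [mutualInfo_eq_divergence, mutualInfo_eq_divergence]
  refine ENNReal.div_le_div_right ?_ _
  have h1 := outEntropy_le_outEntropy_isotropize v μ
  rw [← hd.divergence_add_condEntropy μ, ← hd.divergence_add_condEntropy (isotropize μ),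
    condEntropy_isotropize] at h1
  exact (ENNReal.add_le_add_iff_right (condEntropy_ne_top v μ h)).1 h1

/-- Only the right unitary orbits of the input matter for the isotropised law. -/
lemma map_mul_eq_isotropize {f : Matrix (Fin M) (Fin T) ℂ → Matrix (Fin M) (Fin T) ℂ}
    (hf : Measurable f)
    (hU : ∀ X, ∃ U : Matrix.unitaryGroup (Fin T) ℂ, f X = X * (U : Matrix (Fin T) (Fin T) ℂ)) :
    (μ.prod (unitaryHaar T)).map (fun z => f z.1 * (z.2 : Matrix (Fin T) (Fin T) ℂ)) =
      isotropize μ := by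
  have hm : Measurable fun z : Matrix (Fin M) (Fin T) ℂ × Matrix.unitaryGroup (Fin T) ℂ =>
      f z.1 * (z.2 : Matrix (Fin T) (Fin T) ℂ) :=
    measurable_mul_coe.comp ((hf.comp measurable_fst).prodMk measurable_snd)
  refine Measure.ext_of_lintegral _ fun k hk => ?_
  rw [lintegral_isotropize μ hk, lintegral_map hk hm,
    lintegral_prod (fun z : Matrix (Fin M) (Fin T) ℂ × Matrix.unitaryGroup (Fin T) ℂ =>
      k (f z.1 * (z.2 : Matrix (Fin T) (Fin T) ℂ))) (hk.comp hm).aemeasurable]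
  refine lintegral_congr fun x => ?_
  obtain ⟨U, hUx⟩ := hU x
  -- Left invariance of Haar measure absorbs `U`, which may depend on `x` in any way; no measurable
  -- choice of `U` is needed.
  rw [← lintegral_mul_left_eq_self
    (fun V : Matrix.unitaryGroup (Fin T) ℂ => k (x * (V : Matrix (Fin T) (Fin T) ℂ))) U]
  simp only [hUx, Matrix.UnitaryGroup.mul_val, Matrix.mul_assoc]

end Unitary

/-! ### Measurable triangularisation by Householder reflections -/

section Householder

variable {M T : ℕ}

/-- The reflection, acting on row vectors from the right, in the hyperplane orthogonal to `w`. -/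
noncomputable def householder (w : Fin T → ℂ) : Matrix (Fin T) (Fin T) ℂ :=
  1 - (2 / ∑ k, w k * star (w k)) • Matrix.vecMulVec (star w) w

lemma householder_mem_unitaryGroup (w : Fin T → ℂ) :
    householder w ∈ Matrix.unitaryGroup (Fin T) ℂ := by
  set n := ∑ k, w k * star (w k)
  set A := Matrix.vecMulVec (star w) w
  have hn : star n = n := by simp [n, mul_comm]
  have hA : star A = A := by
    ext i j
    simp [A, Matrix.star_apply, Matrix.vecMulVec_apply, mul_comm]
  have hAA : A * A = n • A := by
    ext i j
    simp only [Matrix.mul_apply, A, Matrix.vecMulVec_apply, Matrix.smul_apply, n, smul_eq_mul,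
      Finset.sum_mul]
    exact Finset.sum_congr rfl fun k _ => by simp only [Pi.star_apply]; ring
  have hH : star (householder w) = householder w := by
    change star (1 - (2 / n) • A) = 1 - (2 / n) • A
    rw [star_sub, star_one, star_smul, hA, star_div₀, hn]
    simp
  rw [Matrix.mem_unitaryGroup_iff, hH]
  change (1 - (2 / n) • A) * (1 - (2 / n) • A) = 1
  -- When `w = 0` the convention `2 / 0 = 0` turns the reflection into the identity, so no case
  -- needs excluding.
  have h : (2 / n) * (2 / n) * n = 2 / n + 2 / n := by
    by_cases h0 : n = 0
    · simp [h0]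
    · field_simp; norm_num
  rw [sub_mul, mul_sub, mul_sub, mul_one, mul_one, one_mul, smul_mul_smul_comm, hAA, smul_smul, h,
    add_smul]
  abel

lemma mul_householder_apply (X : Matrix (Fin M) (Fin T) ℂ) (w : Fin T → ℂ) (r : Fin M)
    (c : Fin T) : (X * householder w) r c =
      X r c - 2 / (∑ k, w k * star (w k)) * (∑ k, X r k * star (w k)) * w c := by
  rw [householder, Matrix.mul_sub, Matrix.mul_one, Matrix.mul_smul, Matrix.sub_apply,
    Matrix.smul_apply, Matrix.mul_apply]
  simp only [Matrix.vecMulVec_apply, smul_eq_mul, Pi.star_apply]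
  rw [mul_assoc, Finset.sum_mul]
  congr 2
  exact Finset.sum_congr rfl fun k _ => by ring

/-- A unimodular number with the argument of `z`. -/
noncomputable def unitPhase (z : ℂ) : ℂ := if z = 0 then 1 else z / ‖z‖

lemma measurable_unitPhase : Measurable unitPhase :=
  Measurable.ite (measurableSet_singleton 0) measurable_const (by fun_prop)

lemma unitPhase_mul_star_self (z : ℂ) : unitPhase z * star (unitPhase z) = 1 := by
  unfold unitPhase
  split_ifs with h
  · simp
  · have hz : (‖z‖ : ℂ) ≠ 0 := by simpa using h
    rw [star_div₀]
    simp only [RCLike.star_def, Complex.conj_ofReal]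
    rw [div_mul_div_comm, Complex.mul_conj']
    field_simp

lemma unitPhase_mul_star (z : ℂ) : unitPhase z * star z = z * star (unitPhase z) := by
  unfold unitPhase
  split_ifs with h
  · simp [h]
  · rw [star_div₀]
    simp only [RCLike.star_def, Complex.conj_ofReal]
    ring

/-- The entries of row `i` from column `l` on. -/
def rowTail (X : Matrix (Fin M) (Fin T) ℂ) (i : Fin M) (l k : Fin T) : ℂ :=
  if l ≤ k then X i k else 0

/-- The Householder vector that clears row `i` to the right of column `l`. -/
noncomputable def clearingVector (X : Matrix (Fin M) (Fin T) ℂ) (i : Fin M) (l : Fin T) :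
    Fin T → ℂ :=
  rowTail X i l - Pi.single l ((√(∑ k, ‖rowTail X i l k‖ ^ 2) : ℝ) * unitPhase (X i l))

lemma measurable_rowTail (i : Fin M) (l k : Fin T) :
    Measurable fun X : Matrix (Fin M) (Fin T) ℂ => rowTail X i l k := by
  unfold rowTail
  split_ifs
  · exact measurable_entry i k
  · exact measurable_const

lemma measurable_clearingVector (i : Fin M) (l k : Fin T) :
    Measurable fun X : Matrix (Fin M) (Fin T) ℂ => clearingVector X i l k := by
  have h1 := fun k => measurable_rowTail (M := M) i l k
  have h2 : Measurable fun X : Matrix (Fin M) (Fin T) ℂ =>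
      ((√(∑ k, ‖rowTail X i l k‖ ^ 2) : ℝ) : ℂ) * unitPhase (X i l) :=
    (Complex.measurable_ofReal.comp (Finset.measurable_sum _ fun k _ =>
      (h1 k).norm.pow_const 2).sqrt).mul (measurable_unitPhase.comp (measurable_entry i l))
  unfold clearingVector
  refine (h1 k).sub ?_
  by_cases hk : k = l
  · subst hk; simpa using h2
  · simp [Pi.single_eq_of_ne hk]

lemma measurable_mul_householder (i : Fin M) (l : Fin T) :
    Measurable fun X : Matrix (Fin M) (Fin T) ℂ => X * householder (clearingVector X i l) := by
  refine measurable_pi_lambda _ fun r => measurable_pi_lambda _ fun c => ?_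
  have hw := fun k => measurable_clearingVector (M := M) i l k
  have hs := fun k => (continuous_star.measurable (α := ℂ)).comp (hw k)
  simp only [mul_householder_apply]
  exact (measurable_entry r c).sub (((measurable_const.div (Finset.measurable_sum _ fun k _ =>
    (hw k).mul (hs k))).mul (Finset.measurable_sum _ fun k _ =>
      (measurable_entry r k).mul (hs k))).mul (hw c))

lemma clearingVector_of_lt (X : Matrix (Fin M) (Fin T) ℂ) (i : Fin M) {l k : Fin T} (h : k < l) :
    clearingVector X i l k = 0 := by
  simp [clearingVector, rowTail, not_le.2 h, Pi.single_eq_of_ne h.ne]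

lemma clearingVector_of_gt (X : Matrix (Fin M) (Fin T) ℂ) (i : Fin M) {l k : Fin T} (h : l < k) :
    clearingVector X i l k = X i k := by
  simp [clearingVector, rowTail, h.le, Pi.single_eq_of_ne h.ne']

/-- Write `w = v - α e_l`, where `v` is the row tail. Since `|α| = ‖v‖` and `α` has the phase of
`v_l`, which makes `α * star (v l)` real, ‖w‖² = 2⟨v, w⟩. This makes the coefficient of `w` in the
reflection equal to one, so that `v` is sent to `v - w = α e_l`. -/
lemma sum_clearingVector (X : Matrix (Fin M) (Fin T) ℂ) (i : Fin M) (l : Fin T) :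
    ∑ k, clearingVector X i l k * star (clearingVector X i l k) =
      2 * ∑ k, X i k * star (clearingVector X i l k) := by
  set v := rowTail X i l with hv
  set S := ∑ k, ‖v k‖ ^ 2
  set α : ℂ := (√S : ℝ) * unitPhase (X i l) with hα
  set w := clearingVector X i l with hw
  have hwk : ∀ k, w k = v k - (Pi.single l α : Fin T → ℂ) k := fun k => rfl
  have hvl : v l = X i l := by simp [hv, rowTail]
  have hαS : α * star α = S := by
    have hS : 0 ≤ S := Finset.sum_nonneg fun _ _ => by positivity
    rw [hα, star_mul']
    simp only [RCLike.star_def, Complex.conj_ofReal]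
    rw [mul_mul_mul_comm, ← Complex.ofReal_mul, mul_self_sqrt hS]
    have := unitPhase_mul_star_self (X i l)
    simp only [RCLike.star_def] at this
    rw [this, mul_one]
  have hαv : α * star (v l) = v l * star α := by
    have := unitPhase_mul_star (X i l)
    rw [hα, hvl, star_mul']
    simp only [RCLike.star_def, Complex.conj_ofReal] at this ⊢
    linear_combination (√S : ℂ) * this
  have hvS : ∑ k, v k * star (v k) = S := by
    simp only [RCLike.star_def, Complex.mul_conj', S]
    push_cast
    rfl
  have hX : ∑ k, X i k * star (w k) = ∑ k, v k * star (w k) := by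
    refine Finset.sum_congr rfl fun k _ => ?_
    rcases lt_or_ge k l with h | h
    · rw [hw, clearingVector_of_lt X i h]; simp
    · simp [hv, rowTail, h]
  have hsingle : ∀ f : Fin T → ℂ, ∑ k, (Pi.single l α : Fin T → ℂ) k * f k = α * f l := by
    intro f
    rw [Finset.sum_eq_single l] <;> simp +contextual [Pi.single_eq_of_ne]
  have hsingle' : ∑ k, v k * star ((Pi.single l α : Fin T → ℂ) k) = v l * star α := by
    rw [Finset.sum_eq_single l] <;> simp +contextual [Pi.single_eq_of_ne]
  have hd : ∑ k, v k * star (w k) = S - v l * star α := by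
    simp only [hwk, star_sub, mul_sub, Finset.sum_sub_distrib]
    rw [hvS, hsingle']
  have hn : ∑ k, w k * star (w k) = ∑ k, v k * star (w k) - α * star (w l) := by
    rw [← hsingle fun k => star (w k), ← Finset.sum_sub_distrib]
    exact Finset.sum_congr rfl fun k _ => by rw [hwk k]; ring
  have hwl : star (w l) = star (v l) - star α := by rw [hwk, Pi.single_eq_same, star_sub]
  rw [hX, hn, hwl, hd]
  linear_combination hαS - hαv

/-- Right multiplication by the reflection keeps the rows above `i` that already vanish from
column `l` on and clears row `i` to the right of column `l`. -/
lemma mul_householder_clearingVector (X : Matrix (Fin M) (Fin T) ℂ) (i : Fin M) (l : Fin T) :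
    (∀ r, (∀ k, l ≤ k → X r k = 0) →
      ∀ c, (X * householder (clearingVector X i l)) r c = X r c) ∧
    ∀ c, l < c → (X * householder (clearingVector X i l)) i c = 0 := by
  refine ⟨fun r hr c => ?_, fun c hc => ?_⟩
  · have h : ∑ k, X r k * star (clearingVector X i l k) = 0 := by
      refine Finset.sum_eq_zero fun k _ => ?_
      rcases lt_or_ge k l with h | h
      · rw [clearingVector_of_lt X i h]; simp
      · rw [hr k h, zero_mul]
    rw [mul_householder_apply, h]
    ring
  · rw [mul_householder_apply, clearingVector_of_gt X i hc]
    have h := sum_clearingVector X i l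
    set d := ∑ k, X i k * star (clearingVector X i l k)
    -- If `d = 0` then `w = 0`, and the entry to be cleared, being an entry of `w`, already
    -- vanishes.
    by_cases hd : d = 0
    · have h0 : ∑ k, ‖clearingVector X i l k‖ ^ 2 = 0 := by
        rw [hd, mul_zero] at h
        simp only [RCLike.star_def, Complex.mul_conj'] at h
        exact_mod_cast h
      rw [Finset.sum_eq_zero_iff_of_nonneg fun _ _ => by positivity] at h0
      have := h0 c (Finset.mem_univ c)
      rw [clearingVector_of_gt X i hc] at this
      have hz : X i c = 0 := by simpa using this
      rw [hz]; ring
    · rw [h]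
      field_simp
      ring

/-- Measurable reduction to lower triangular form by right unitary multiplication. -/
lemma exists_measurable_lowerTriangular :
    ∃ f : Matrix (Fin M) (Fin T) ℂ → Matrix (Fin M) (Fin T) ℂ, Measurable f ∧
      (∀ X, IsLowerTriangular (f X)) ∧
      ∀ X, ∃ U : Matrix.unitaryGroup (Fin T) ℂ, f X = X * (U : Matrix (Fin T) (Fin T) ℂ) := by
  suffices h : ∀ n ≤ M, ∃ f : Matrix (Fin M) (Fin T) ℂ → Matrix (Fin M) (Fin T) ℂ, Measurable f ∧
      (∀ X (i : Fin M) (j : Fin T), (i : ℕ) < n → (i : ℕ) < j → f X i j = 0) ∧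
      ∀ X, ∃ U : Matrix.unitaryGroup (Fin T) ℂ, f X = X * (U : Matrix (Fin T) (Fin T) ℂ) by
    obtain ⟨f, hf, htri, hU⟩ := h M le_rfl
    exact ⟨f, hf, fun X i j hij => htri X i j i.2 hij, hU⟩
  intro n
  induction n with
  | zero =>
    exact fun _ => ⟨id, measurable_id, fun _ _ _ h => absurd h (Nat.not_lt_zero _),
      fun X => ⟨1, by simp⟩⟩
  | succ n ih =>
    intro hn
    obtain ⟨f, hf, htri, hU⟩ := ih (Nat.le_of_succ_le hn)
    -- Row `n` is cleared beyond its diagonal column `n`. Earlier rows already vanish from that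
    -- column on, so the reflection fixes them. Once `n ≥ T` there is nothing to the right of the
    -- diagonal.
    rcases lt_or_ge n T with hT | hT
    · let i : Fin M := ⟨n, hn⟩
      let l : Fin T := ⟨n, hT⟩
      refine ⟨fun X => f X * householder (clearingVector (f X) i l),
        (measurable_mul_householder i l).comp hf, fun X r c hr hrc => ?_, fun X => ?_⟩
      · change (f X * householder (clearingVector (f X) i l)) r c = 0
        obtain ⟨h1, h2⟩ := mul_householder_clearingVector (f X) i l
        rcases Nat.lt_succ_iff_lt_or_eq.1 hr with h | h
        · rw [h1 r (fun k hk => htri X r k h (lt_of_lt_of_le h hk)), htri X r c h hrc]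
        · have hri : r = i := Fin.ext h
          rw [hri]
          refine h2 c ?_
          rw [Fin.lt_def]
          change n < (c : ℕ)
          omega
      · obtain ⟨U, hUX⟩ := hU X
        refine ⟨U * ⟨_, householder_mem_unitaryGroup (clearingVector (f X) i l)⟩, ?_⟩
        rw [Matrix.UnitaryGroup.mul_val, ← Matrix.mul_assoc, ← hUX]
    · refine ⟨f, hf, fun X r c hr hrc => ?_, hU⟩
      exact htri X r c (lt_of_lt_of_le (hrc.trans c.2) hT) hrc

end Householder

end NoncoherentMIMO

theorem theorem1 {M N T : ℕ} (hM : 0 < M) (hT : 0 < T) (v : Fin N → Fin M → ℝ≥0) :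
    ∃ (Ω : Type) (_ : MeasurableSpace Ω) (P : Measure Ω) (_ : IsProbabilityMeasure P)
      (L : Ω → Matrix (Fin M) (Fin T) ℂ) (Q : Ω → Matrix.unitaryGroup (Fin T) ℂ),
      Measurable L ∧ Measurable Q ∧
      (∀ ω, NoncoherentMIMO.IsLowerTriangular (L ω)) ∧
      (P.map Q).IsHaarMeasure ∧
      IndepFun L Q P ∧
      NoncoherentMIMO.avgPower (P.map fun ω => L ω * (Q ω : Matrix (Fin T) (Fin T) ℂ)) = 1 ∧
      NoncoherentMIMO.mutualInfo v (P.map fun ω => L ω * (Q ω : Matrix (Fin T) (Fin T) ℂ)) =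
        NoncoherentMIMO.capacity T v := by
  obtain ⟨μ, hμ, hpow, hcap⟩ :=
    NoncoherentMIMO.exists_avgPower_eq_one_mutualInfo_eq_capacity v hM hT
  obtain ⟨f, hf, htri, hU⟩ := NoncoherentMIMO.exists_measurable_lowerTriangular (M := M) (T := T)
  have hlaw := NoncoherentMIMO.map_mul_eq_isotropize μ hf hU
  have hiso : NoncoherentMIMO.avgPower (NoncoherentMIMO.isotropize μ) = 1 := by
    rw [NoncoherentMIMO.avgPower_isotropize, hpow]
  -- The sample space carries an optimal `X` and an independent Haar `Q`, with `L` the triangular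
  -- representative of `X`; the law of `L Q` is then that of `X Q`.
  refine ⟨Matrix (Fin M) (Fin T) ℂ × Matrix.unitaryGroup (Fin T) ℂ, inferInstance,
    μ.prod (NoncoherentMIMO.unitaryHaar T), inferInstance, fun ω => f ω.1, Prod.snd,
    hf.comp measurable_fst, measurable_snd, fun ω => htri _, ?_, ?_, ?_, ?_⟩
  · have : (μ.prod (NoncoherentMIMO.unitaryHaar T)).map Prod.snd = NoncoherentMIMO.unitaryHaar T :=
      Measure.snd_prod
    rw [this]
    infer_instance
  · exact indepFun_prod hf measurable_id
  · rw [hlaw, hiso]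
  · rw [hlaw]
    refine le_antisymm ?_ ?_
    · exact le_iSup_of_le _ (le_iSup_of_le inferInstance (le_iSup_of_le hiso le_rfl))
    · rw [← hcap]
      refine NoncoherentMIMO.mutualInfo_le_mutualInfo_isotropize v μ ?_
      rw [(NoncoherentMIMO.avgPower_eq_one_iff hM hT μ).1 hpow]
      finiteness
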